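/- Let $\mathbf k$ be an algebraically closed field of any characteristic, let $\Delta$ be a (finite, nonempty) fan of strongly convex rational polyhedral cones in $N_{\mathbb R}$, $N\simeq\mathbb Z^n$, with $M=\mathrm{Hom}(N,\mathbb Z)$, and let $X=X(\Delta)$ be the associated toric variety over $\mathbf k$, with dense torus $T=\mathrm{Spec}\,\mathbf k[M]$ and identity $1\in T\subseteq X$. Assume that $X$ is complete and $\mathbb Q$-factorial (every Weil divisor has a positive multiple that is Cartier). Let $T_X=\mathcal Hom(\Omega^1_{X/\mathbf k},\mathcal O_X)$ be the tangent sheaf. Then $$\varepsilon(T_X,1)\ \geq\ 0 .$$ Here, for a coherent sheaf $\mathcal F$ on $X$ and a closed point $p\in X$, the Seshadri constant is $$\varepsilon(\mathcal F,p):=\inf_{p\in C\subseteq X}\frac{\overline\mu_{\min}(\nu^*\mathcal F)}{\mathrm{mult}_p(C)}\in\mathbb R\cup\{\pm\infty\},$$ where $C$ runs over the irreducible (reduced, closed) curves in $X$ through $p$ and $\nu:\tilde C\to C\subseteq X$ is the normalization (the infimum over the empty set is $+\infty$). For a coherent sheaf $\mathcal G$ on a smooth projective curve $\tilde C$, $\mu_{\min}(\mathcal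 G)$ is the minimum of the slopes $\mu(\mathcal H)=\deg\mathcal H/\mathrm{rk}\,\mathcal H$ over the coherent quotients $\mathcal H$ of $\mathcal G$, where $\deg\mathcal H=\chi(\mathcal H)-\mathrm{rk}\,\mathcal H\cdot\chi(\mathcal O_{\tilde C})$ and $\mu(\mathcal H)=\infty$ if $\mathcal H$ is torsion; and $\overline\mu_{\min}(\mathcal G)=\mu_{\min}(\mathcal G)$ if $\mathrm{char}\,\mathbf k=0$, while $\overline\mu_{\min}(\mathcal G)=\lim_{e\to\infty}\mu_{\min}((F^e)^*\mathcal G)/p^e$ if $\mathrm{char}\,\mathbf k=p>0$, with $F$ the absolute Frobenius morphism of $\tilde C$. -/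

import Mathlib

open CategoryTheory AlgebraicGeometry Limits

universe u

noncomputable section

namespace ToricSeshadri

section Fans

variable {n : ℕ}

/-- The pairing `⟨m, v⟩` of `m ∈ M = Hom(N, ℤ)` with `v ∈ N_ℝ`, for the lattice `N = ℤⁿ`. -/
def pairing (m : Fin n → ℤ) (v : Fin n → ℝ) : ℝ := ∑ i, (m i : ℝ) * v i

lemma pairing_zero_left (v : Fin n → ℝ) : pairing 0 v = 0 := by simp [pairing]

lemma pairing_add_left (m m' : Fin n → ℤ) (v : Fin n → ℝ) :
    pairing (m + m') v = pairing m v + pairing m' v := by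
  simp [pairing, add_mul, Finset.sum_add_distrib]

lemma pairing_neg_left (m : Fin n → ℤ) (v : Fin n → ℝ) : pairing (-m) v = - pairing m v := by
  simp [pairing]

lemma pairing_nsmul_left (c : ℕ) (m : Fin n → ℤ) (v : Fin n → ℝ) :
    pairing (c • m) v = c * pairing m v := by
  simp [pairing, Finset.mul_sum, mul_assoc]

lemma pairing_add_right (m : Fin n → ℤ) (v w : Fin n → ℝ) :
    pairing m (v + w) = pairing m v + pairing m w := by
  simp [pairing, mul_add, Finset.sum_add_distrib]

lemma pairing_smul_right (m : Fin n → ℤ) (c : ℝ) (v : Fin n → ℝ) :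
    pairing m (c • v) = c * pairing m v := by
  simp [pairing, Finset.mul_sum, mul_left_comm]

lemma pairing_zero_right (m : Fin n → ℤ) : pairing m 0 = 0 := by simp [pairing]

/-- A rational polyhedral cone in `N_ℝ = ℝⁿ`: the convex cone generated by finitely many vectors
of the lattice `N = ℤⁿ`. -/
def IsRationalPolyhedral (σ : PointedCone ℝ (Fin n → ℝ)) : Prop :=
  ∃ s : Finset (Fin n → ℤ), σ = PointedCone.hull ℝ ((fun v i => (v i : ℝ)) '' (s : Set (Fin n → ℤ)))

/-- `τ` is a face of the (rational polyhedral) cone `σ`: there is `m ∈ σ^∨ ∩ M` such that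
`τ = σ ∩ m^⊥`. -/
def IsFace (τ σ : PointedCone ℝ (Fin n → ℝ)) : Prop :=
  ∃ m : Fin n → ℤ, (∀ v ∈ σ, 0 ≤ pairing m v) ∧ ∀ v, v ∈ τ ↔ v ∈ σ ∧ pairing m v = 0

variable (n) in
/-- A (finite) fan in the lattice `N = ℤⁿ`. A nonempty fan contains the zero cone, which is a face
of every strongly convex rational polyhedral cone; this is recorded as `bot_mem`. -/
structure Fan where
  /-- the cones of the fan -/
  cones : Set (PointedCone ℝ (Fin n → ℝ))
  finite : cones.Finite
  rational : ∀ σ ∈ cones, IsRationalPolyhedral σ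
  stronglyConvex : ∀ σ ∈ cones, ∀ v ∈ σ, -v ∈ σ → v = 0
  face_mem : ∀ σ ∈ cones, ∀ τ, IsFace τ σ → τ ∈ cones
  inter_face : ∀ σ ∈ cones, ∀ τ ∈ cones, IsFace (σ ⊓ τ) σ ∧ IsFace (σ ⊓ τ) τ
  bot_mem : ⊥ ∈ cones

/-- The monoid `σ^∨ ∩ M`. -/
def dualMonoid (σ : PointedCone ℝ (Fin n → ℝ)) : AddSubmonoid (Fin n → ℤ) where
  carrier := {m | ∀ v ∈ σ, 0 ≤ pairing m v}
  zero_mem' := fun v _ => by simp [pairing_zero_left]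
  add_mem' := fun {a b} ha hb v hv => by
    rw [pairing_add_left]
    exact add_nonneg (ha v hv) (hb v hv)

lemma dualMonoid_anti {τ σ : PointedCone ℝ (Fin n → ℝ)} (h : τ ≤ σ) :
    dualMonoid σ ≤ dualMonoid τ := fun _ hm v hv => hm v (h hv)

/-- If `τ = σ ∩ m^⊥`, every element of `τ^∨ ∩ M` lands in `σ^∨ ∩ M` after adding a large multiple
of `m`. -/
lemma exists_nsmul_add_mem {τ σ : PointedCone ℝ (Fin n → ℝ)} (hσ : IsRationalPolyhedral σ)
    {m : Fin n → ℤ} (hm : ∀ v ∈ σ, 0 ≤ pairing m v)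
    (hτ : ∀ v, v ∈ τ ↔ v ∈ σ ∧ pairing m v = 0) {a : Fin n → ℤ} (ha : a ∈ dualMonoid τ) :
    ∃ N : ℕ, ∀ K, N ≤ K → K • m + a ∈ dualMonoid σ := by
  obtain ⟨s, rfl⟩ := hσ
  have key : ∀ v ∈ s, ∃ N : ℕ, ∀ K : ℕ, N ≤ K →
      0 ≤ pairing (K • m + a) (fun i => (v i : ℝ)) := by
    intro v hv
    have hvσ : (fun i => (v i : ℝ)) ∈ PointedCone.hull ℝ
        ((fun (v : Fin n → ℤ) i => (v i : ℝ)) '' (s : Set (Fin n → ℤ))) :=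
      PointedCone.subset_hull ⟨v, hv, rfl⟩
    rcases (hm _ hvσ).eq_or_lt with h0 | hpos
    · refine ⟨0, fun K _ => ?_⟩
      rw [pairing_add_left, pairing_nsmul_left, ← h0, mul_zero, zero_add]
      exact ha _ ((hτ _).2 ⟨hvσ, h0.symm⟩)
    · obtain ⟨N, hN⟩ := exists_nat_ge
        (- pairing a (fun i => (v i : ℝ)) / pairing m (fun i => (v i : ℝ)))
      refine ⟨N, fun K hK => ?_⟩
      rw [pairing_add_left, pairing_nsmul_left]
      rw [div_le_iff₀ hpos] at hN
      have : (N : ℝ) * pairing m (fun i => (v i : ℝ)) ≤ K * pairing m (fun i => (v i : ℝ)) := by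
        gcongr
      linarith
  choose! N hN using key
  refine ⟨s.sup N, fun K hK v hv => ?_⟩
  induction hv using Submodule.span_induction with
  | mem x hx =>
    obtain ⟨w, hw, rfl⟩ := hx
    exact hN w hw K ((Finset.le_sup hw).trans hK)
  | zero => rw [pairing_zero_right]
  | add x y _ _ hx hy => rw [pairing_add_right]; exact add_nonneg hx hy
  | smul c x _ hx =>
    have : c • x = (c : ℝ) • x := rfl
    rw [this, pairing_smul_right]
    exact mul_nonneg c.2 hx

end Fans

section ToricVariety

variable {n : ℕ} (k : Type u) [Field k]

/-- The coordinate ring `k[σ^∨ ∩ M]` of the affine chart `U_σ`. -/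
abbrev ChartRing (σ : PointedCone ℝ (Fin n → ℝ)) : Type u :=
  AddMonoidAlgebra k (dualMonoid σ)

/-- The inclusion `k[σ^∨ ∩ M] → k[τ^∨ ∩ M]` for `τ ⊆ σ`. -/
def chartRingMap {τ σ : PointedCone ℝ (Fin n → ℝ)} (h : τ ≤ σ) :
    ChartRing k σ →+* ChartRing k τ :=
  AddMonoidAlgebra.mapDomainRingHom k (AddSubmonoid.inclusion (dualMonoid_anti h))

lemma chartRingMap_single {τ σ : PointedCone ℝ (Fin n → ℝ)} (h : τ ≤ σ) (a : dualMonoid σ)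
    (c : k) : chartRingMap k h (AddMonoidAlgebra.single a c) =
      AddMonoidAlgebra.single (AddSubmonoid.inclusion (dualMonoid_anti h) a) c := by
  simp [chartRingMap]

lemma chartRingMap_injective {τ σ : PointedCone ℝ (Fin n → ℝ)} (h : τ ≤ σ) :
    Function.Injective (chartRingMap k h) :=
  AddMonoidAlgebra.mapDomain_injective (AddSubmonoid.inclusion_injective (dualMonoid_anti h))

lemma chartRingMap_id (σ : PointedCone ℝ (Fin n → ℝ)) :
    chartRingMap k (le_refl σ) = RingHom.id _ :=
  AddMonoidAlgebra.mapDomainRingHom_id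

lemma chartRingMap_comp {υ τ σ : PointedCone ℝ (Fin n → ℝ)} (h : υ ≤ τ) (h' : τ ≤ σ) :
    (chartRingMap k h).comp (chartRingMap k h') = chartRingMap k (h.trans h') :=
  (AddMonoidAlgebra.mapDomainRingHom_comp (R := k) _ _).symm

/-- If `τ = σ ∩ m^⊥`, then `k[τ^∨ ∩ M]` is the localization of `k[σ^∨ ∩ M]` at `χ^m`. -/
lemma isLocalization_chartRingMap {τ σ : PointedCone ℝ (Fin n → ℝ)} (h : τ ≤ σ)
    (hσ : IsRationalPolyhedral σ) (m : dualMonoid σ)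
    (hτ : ∀ v, v ∈ τ ↔ v ∈ σ ∧ pairing m.1 v = 0) :
    letI := (chartRingMap k h).toAlgebra
    IsLocalization.Away (AddMonoidAlgebra.single m 1 : ChartRing k σ) (ChartRing k τ) := by
  let _ := (chartRingMap k h).toAlgebra
  have halg : ∀ x, algebraMap (ChartRing k σ) (ChartRing k τ) x = chartRingMap k h x :=
    fun _ => rfl
  have hneg : -m.1 ∈ dualMonoid τ := fun v hv => by
    rw [pairing_neg_left, ((hτ v).1 hv).2, neg_zero]
  have hpow : ∀ j : ℕ, algebraMap (ChartRing k σ) (ChartRing k τ)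
      (AddMonoidAlgebra.single m 1) ^ j =
      AddMonoidAlgebra.single (AddSubmonoid.inclusion (dualMonoid_anti h) (j • m)) 1 := by
    intro j
    rw [← map_pow, halg, AddMonoidAlgebra.single_pow, one_pow, chartRingMap_single]
  refine IsLocalization.Away.mk _ ?_ ?_ ?_
  · refine IsUnit.of_mul_eq_one (AddMonoidAlgebra.single ⟨-m.1, hneg⟩ 1) ?_
    rw [halg, chartRingMap_single, AddMonoidAlgebra.single_mul_single, one_mul,
      AddMonoidAlgebra.one_def]
    congr 1
    ext1
    simp
  · intro s
    suffices H : ∃ N : ℕ, ∀ K, N ≤ K → ∃ a : ChartRing k σ,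
        s * algebraMap (ChartRing k σ) (ChartRing k τ) (AddMonoidAlgebra.single m 1) ^ K =
          algebraMap (ChartRing k σ) (ChartRing k τ) a by
      obtain ⟨N, hN⟩ := H
      exact ⟨N, hN N le_rfl⟩
    induction s using AddMonoidAlgebra.induction_linear with
    | zero => exact ⟨0, fun K _ => ⟨0, by simp⟩⟩
    | add x y hx hy =>
      obtain ⟨N, hN⟩ := hx
      obtain ⟨N', hN'⟩ := hy
      refine ⟨max N N', fun K hK => ?_⟩
      obtain ⟨a, ha⟩ := hN K (le_trans (le_max_left _ _) hK)
      obtain ⟨b, hb⟩ := hN' K (le_trans (le_max_right _ _) hK)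
      exact ⟨a + b, by rw [add_mul, ha, hb, map_add]⟩
    | single a c =>
      obtain ⟨N, hN⟩ := exists_nsmul_add_mem hσ m.2 hτ a.2
      refine ⟨N, fun K hK => ⟨AddMonoidAlgebra.single ⟨_, hN K hK⟩ c, ?_⟩⟩
      rw [hpow, halg, chartRingMap_single, AddMonoidAlgebra.single_mul_single, mul_one]
      congr 1
      ext1
      simp [add_comm]
  · intro a b hab
    exact ⟨0, by rw [chartRingMap_injective k h hab]⟩

/-- The diagram of affine charts `U_σ = Spec k[σ^∨ ∩ M]`, `σ ∈ Δ`, with the inclusions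
`U_τ → U_σ` for `τ ⊆ σ`. -/
def chartDiagram (Δ : Fan n) : Δ.cones ⥤ Scheme.{u} where
  obj σ := Spec (.of (ChartRing k σ.1))
  map {τ σ} f := Spec.map (CommRingCat.ofHom (chartRingMap k (leOfHom f)))
  map_id σ := by
    rw [chartRingMap_id]
    exact Spec.map_id _
  map_comp f g := by
    rw [← Spec.map_comp, ← CommRingCat.ofHom_comp, chartRingMap_comp]

lemma Fan.isFace_of_le (Δ : Fan n) {τ σ : Δ.cones} (h : τ ≤ σ) : IsFace τ.1 σ.1 := by
  have := (Δ.inter_face σ.1 σ.2 τ.1 τ.2).1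
  rwa [inf_eq_right.2 (show τ.1 ≤ σ.1 from h)] at this

lemma isOpenImmersion_chartMap {τ σ : PointedCone ℝ (Fin n → ℝ)} (h : τ ≤ σ)
    (hσ : IsRationalPolyhedral σ) (hτ : IsFace τ σ) :
    IsOpenImmersion (Spec.map (CommRingCat.ofHom (chartRingMap k h))) := by
  obtain ⟨m, hm, hτ⟩ := hτ
  let _ := (chartRingMap k h).toAlgebra
  have := isLocalization_chartRingMap k h hσ ⟨m, hm⟩ hτ
  exact IsOpenImmersion.of_isLocalization (R := ChartRing k σ) (S := ChartRing k τ)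
    (AddMonoidAlgebra.single (⟨m, hm⟩ : dualMonoid σ) 1)

instance (Δ : Fan n) {τ σ : Δ.cones} (f : τ ⟶ σ) :
    IsOpenImmersion ((chartDiagram k Δ).map f) :=
  isOpenImmersion_chartMap k _ (Δ.rational _ σ.2) (Δ.isFace_of_le (leOfHom f))

lemma range_chartMap {τ σ : PointedCone ℝ (Fin n → ℝ)} (h : τ ≤ σ)
    (hσ : IsRationalPolyhedral σ) (m : dualMonoid σ)
    (hτ : ∀ v, v ∈ τ ↔ v ∈ σ ∧ pairing m.1 v = 0) :
    Set.range (Spec.map (CommRingCat.ofHom (chartRingMap k h))) =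
      ((PrimeSpectrum.basicOpen (AddMonoidAlgebra.single m 1 : ChartRing k σ) :
        TopologicalSpace.Opens (PrimeSpectrum (ChartRing k σ))) :
          Set (PrimeSpectrum (ChartRing k σ))) := by
  let _ := (chartRingMap k h).toAlgebra
  have := isLocalization_chartRingMap k h hσ m hτ
  exact PrimeSpectrum.localization_away_comap_range (ChartRing k τ)
    (AddMonoidAlgebra.single m 1 : ChartRing k σ)

instance (Δ : Fan n) : (chartDiagram k Δ ⋙ Scheme.forget).IsLocallyDirected where
  cond {τ τ' σ} f g x y hxy := by
    have hx : (chartDiagram k Δ).map f x = (chartDiagram k Δ).map g y := hxy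
    obtain ⟨m, hm, hτ⟩ := Δ.isFace_of_le (leOfHom f)
    obtain ⟨m', hm', hτ'⟩ := Δ.isFace_of_le (leOfHom g)
    have hυ : ∀ v, v ∈ τ.1 ⊓ τ'.1 ↔ v ∈ σ.1 ∧ pairing (m + m') v = 0 := by
      intro v
      rw [Submodule.mem_inf, hτ, hτ', pairing_add_left]
      constructor
      · rintro ⟨⟨h1, h2⟩, -, h3⟩
        exact ⟨h1, by rw [h2, h3, add_zero]⟩
      · rintro ⟨h1, h2⟩
        have a := hm v h1
        have b := hm' v h1
        exact ⟨⟨h1, by linarith⟩, h1, by linarith⟩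
    let mm : dualMonoid σ.1 := ⟨m, hm⟩ + ⟨m', hm'⟩
    let υ : Δ.cones := ⟨τ.1 ⊓ τ'.1, Δ.face_mem _ τ.2 _ (Δ.inter_face _ τ.2 _ τ'.2).1⟩
    let p : υ ⟶ τ := homOfLE (show υ.1 ≤ τ.1 from inf_le_left)
    let q : υ ⟶ τ' := homOfLE (show υ.1 ≤ τ'.1 from inf_le_right)
    have r1 := range_chartMap k (leOfHom f) (Δ.rational _ σ.2) ⟨m, hm⟩ hτ
    have r2 := range_chartMap k (leOfHom g) (Δ.rational _ σ.2) ⟨m', hm'⟩ hτ'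
    have r3 := range_chartMap k (leOfHom (p ≫ f)) (Δ.rational _ σ.2) mm hυ
    have hmem : (chartDiagram k Δ).map f x ∈ Set.range ((chartDiagram k Δ).map (p ≫ f)) := by
      have h1 : (chartDiagram k Δ).map f x ∈ Set.range ((chartDiagram k Δ).map f) := ⟨x, rfl⟩
      have h2 : (chartDiagram k Δ).map f x ∈ Set.range ((chartDiagram k Δ).map g) :=
        ⟨y, hx.symm⟩
      have hmul : (AddMonoidAlgebra.single mm 1 : ChartRing k σ.1) =
          AddMonoidAlgebra.single ⟨m, hm⟩ 1 * AddMonoidAlgebra.single ⟨m', hm'⟩ 1 := by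
        rw [AddMonoidAlgebra.single_mul_single, one_mul]
      rw [show Set.range ((chartDiagram k Δ).map (p ≫ f)) = _ from r3, hmul,
        PrimeSpectrum.basicOpen_mul]
      exact ⟨r1 ▸ h1, r2 ▸ h2⟩
    obtain ⟨z, hz⟩ := hmem
    refine ⟨υ, p, q, z, ?_, ?_⟩
    · apply ((chartDiagram k Δ).map f).isOpenEmbedding.injective
      rw [← hz, Functor.map_comp]
      rfl
    · apply ((chartDiagram k Δ).map g).isOpenEmbedding.injective
      rw [← hx, ← hz, show p ≫ f = q ≫ g from rfl, Functor.map_comp]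
      rfl

/-- The toric variety `X(Δ)`, obtained by gluing the affine charts `U_σ`, `σ ∈ Δ`. -/
def Fan.toricVariety (Δ : Fan n) : Scheme.{u} := colimit (chartDiagram k Δ)

/-- The open immersion `U_σ → X(Δ)`. -/
def Fan.chart (Δ : Fan n) (σ : Δ.cones) :
    Spec (.of (ChartRing k σ.1)) ⟶ Δ.toricVariety k :=
  colimit.ι (chartDiagram k Δ) σ

/-- The structure morphism `X(Δ) → Spec k`. -/
def Fan.structureMap (Δ : Fan n) : Δ.toricVariety k ⟶ Spec (.of k) :=
  colimit.desc (chartDiagram k Δ)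
    { pt := Spec (.of k)
      ι :=
        { app σ := Spec.map (CommRingCat.ofHom (algebraMap k (ChartRing k σ.1)))
          naturality := by
            intro τ σ f
            refine Eq.trans ?_ (Category.comp_id _).symm
            change Spec.map _ ≫ Spec.map _ = Spec.map _
            rw [← Spec.map_comp, ← CommRingCat.ofHom_comp]
            congr 2
            ext c
            simp [chartRingMap] } }

/-- The ring homomorphism `k[M] = k[0^∨ ∩ M] → k`, `χ^m ↦ 1`, of evaluation at the identity of the
torus `T = Spec k[M]`. -/
def evalOne : ChartRing k (⊥ : PointedCone ℝ (Fin n → ℝ)) →+* k :=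
  (AddMonoidAlgebra.lift k k (dualMonoid (⊥ : PointedCone ℝ (Fin n → ℝ))) 1 :
    ChartRing k (⊥ : PointedCone ℝ (Fin n → ℝ)) →ₐ[k] k).toRingHom

/-- The point `1 ∈ T ⊆ X(Δ)`, the identity of the dense torus. -/
def Fan.one (Δ : Fan n) : Δ.toricVariety k :=
  Δ.chart k ⟨⊥, Δ.bot_mem⟩ (Spec.map (CommRingCat.ofHom (evalOne k)) (⊥ : PrimeSpectrum k))

end ToricVariety
section Tangent

variable {k : Type u} [Field k] {X : Scheme.{u}} (f : X ⟶ Spec (.of k))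

/-- For a scheme `f : X → Spec k`, the `k`-algebra structure `k → Γ(X, U)`. -/
def scalar (U : X.Opens) : k →+* Γ(X, U) :=
  ((Scheme.ΓSpecIso (.of k)).inv ≫ f.appTop ≫ X.presheaf.map (homOfLE le_top).op).hom

/-- Restriction of functions from `U` to `V ⊆ U`. -/
def res {U V : X.Opens} (h : V ≤ U) : Γ(X, U) →+* Γ(X, V) := (X.presheaf.map (homOfLE h).op).hom

lemma res_scalar {U V : X.Opens} (h : V ≤ U) (c : k) : res h (scalar f U c) = scalar f V c := by
  simp only [res, scalar]
  rw [← CommRingCat.comp_apply, Category.assoc, Category.assoc, ← Functor.map_comp]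
  rfl

lemma res_res {U V W : X.Opens} (h : V ≤ U) (h' : W ≤ V) (s : Γ(X, U)) :
    res h' (res h s) = res (h'.trans h) s := by
  simp only [res]
  rw [← CommRingCat.comp_apply, ← Functor.map_comp]
  rfl

lemma res_self {U : X.Opens} (s : Γ(X, U)) : res le_rfl s = s := by
  have : X.presheaf.map (homOfLE (le_refl U)).op = 𝟙 _ := X.presheaf.map_id _
  simp only [res, this]
  rfl

/-- The group of `k`-derivations `𝒪_U → 𝒪_U` of the sheaf of rings `𝒪_U`: families of
`k`-derivations `Γ(X, V) → Γ(X, V)`, `V ⊆ U`, compatible with restriction. -/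
def tangentSections (U : X.Opens) :
    AddSubgroup (∀ V : {V : X.Opens // V ≤ U}, Γ(X, V.1) → Γ(X, V.1)) where
  carrier := {D |
    (∀ V s t, D V (s + t) = D V s + D V t) ∧
    (∀ V s t, D V (s * t) = s * D V t + t * D V s) ∧
    (∀ V c, D V (scalar f V.1 c) = 0) ∧
    ∀ (V W : {V : X.Opens // V ≤ U}) (h : W.1 ≤ V.1) s, res h (D V s) = D W (res h s)}
  zero_mem' := by simp
  add_mem' := by
    rintro D E ⟨h1, h2, h3, h4⟩ ⟨h1', h2', h3', h4'⟩
    refine ⟨fun V s t => ?_, fun V s t => ?_, fun V c => ?_, fun V W h s => ?_⟩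
    · simp only [Pi.add_apply, h1, h1']; ring
    · simp only [Pi.add_apply, h2, h2']; ring
    · simp only [Pi.add_apply, h3, h3', add_zero]
    · simp only [Pi.add_apply, map_add, h4 _ _ h, h4' _ _ h]
  neg_mem' := by
    rintro D ⟨h1, h2, h3, h4⟩
    refine ⟨fun V s t => ?_, fun V s t => ?_, fun V c => ?_, fun V W h s => ?_⟩
    · simp only [Pi.neg_apply, h1]; ring
    · simp only [Pi.neg_apply, h2]; ring
    · simp only [Pi.neg_apply, h3, neg_zero]
    · simp only [Pi.neg_apply, map_neg, h4 _ _ h]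

/-- `Γ(X, U)` acts on derivations by `(a D)(s) = a D(s)`. -/
instance (U : X.Opens) : Module Γ(X, U) (tangentSections f U) where
  smul a D := ⟨fun V s => res V.2 a * D.1 V s, by
    obtain ⟨h1, h2, h3, h4⟩ := D.2
    refine ⟨fun V s t => ?_, fun V s t => ?_, fun V c => ?_, fun V W h s => ?_⟩
    · simp only [h1]; ring
    · simp only [h2]; ring
    · simp only [h3, mul_zero]
    · simp only [map_mul, h4 _ _ h, res_res]⟩
  one_smul D := Subtype.ext (by funext V s; exact (by rw [map_one, one_mul] :
    res V.2 1 * D.1 V s = D.1 V s))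
  mul_smul a b D := Subtype.ext (by funext V s; exact (by rw [map_mul, mul_assoc] :
    res V.2 (a * b) * D.1 V s = res V.2 a * (res V.2 b * D.1 V s)))
  smul_zero a := Subtype.ext (by funext V s; exact mul_zero (res V.2 a))
  smul_add a D E := Subtype.ext (by funext V s; exact mul_add (res V.2 a) (D.1 V s) (E.1 V s))
  add_smul a b D := Subtype.ext (by funext V s; exact (by rw [map_add, add_mul] :
    res V.2 (a + b) * D.1 V s = res V.2 a * D.1 V s + res V.2 b * D.1 V s))
  zero_smul D := Subtype.ext (by funext V s; exact (by rw [map_zero, zero_mul] :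
    res V.2 0 * D.1 V s = 0))

lemma tangentSections_smul_apply {U : X.Opens} (a : Γ(X, U)) (D : tangentSections f U)
    (V : {V : X.Opens // V ≤ U}) (s : Γ(X, V.1)) : (a • D).1 V s = res V.2 a * D.1 V s := rfl

/-- Restriction of derivations to a smaller open set. -/
def tangentRestrict {U V : X.Opens} (h : V ≤ U) : tangentSections f U →+ tangentSections f V where
  toFun D := ⟨fun W => D.1 ⟨W.1, W.2.trans h⟩, by
    obtain ⟨h1, h2, h3, h4⟩ := D.2
    exact ⟨fun W => h1 ⟨W.1, W.2.trans h⟩, fun W => h2 ⟨W.1, W.2.trans h⟩,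
      fun W => h3 ⟨W.1, W.2.trans h⟩, fun W W' => h4 ⟨W.1, W.2.trans h⟩ ⟨W'.1, W'.2.trans h⟩⟩⟩
  map_zero' := rfl
  map_add' _ _ := rfl

/-- The presheaf of abelian groups `U ↦ Der_k(𝒪_U, 𝒪_U)`. -/
def tangentPresheaf : TopCat.Presheaf Ab.{u} X where
  obj U := AddCommGrpCat.of (tangentSections f U.unop)
  map i := AddCommGrpCat.ofHom (tangentRestrict f (leOfHom i.unop))
  map_id _ := rfl
  map_comp _ _ := rfl

instance (U : X.Opensᵒᵖ) :
    Module (X.ringCatSheaf.obj.obj U) ((tangentPresheaf f).obj U) :=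
  inferInstanceAs (Module Γ(X, U.unop) (tangentSections f U.unop))

/-- Locality and gluing of functions. -/
lemma exists_unique_glue {ι : Type u} (U : ι → X.Opens) (V : X.Opens) (hV : V ≤ iSup U)
    (t : ∀ i, Γ(X, V ⊓ U i))
    (ht : ∀ i j, res (le_inf inf_le_left (inf_le_right.trans inf_le_left) :
        V ⊓ (U i ⊓ U j) ≤ V ⊓ U i) (t i) =
      res (le_inf inf_le_left (inf_le_right.trans inf_le_right) :
        V ⊓ (U i ⊓ U j) ≤ V ⊓ U j) (t j)) :
    ∃! s : Γ(X, V), ∀ i, res (inf_le_left : V ⊓ U i ≤ V) s = t i := by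
  have hcov : V ≤ ⨆ i, V ⊓ U i := by rw [← inf_iSup_eq]; exact le_inf le_rfl hV
  refine X.sheaf.existsUnique_gluing' (fun i => V ⊓ U i) V
    (fun i => homOfLE inf_le_left) hcov t ?_
  intro i j
  have h : (V ⊓ U i) ⊓ (V ⊓ U j) ≤ V ⊓ (U i ⊓ U j) :=
    le_inf (inf_le_left.trans inf_le_left)
      (le_inf (inf_le_left.trans inf_le_right) (inf_le_right.trans inf_le_right))
  have := congrArg (res h) (ht i j)
  rw [res_res, res_res] at this
  exact this

lemma eq_of_res_eq {ι : Type u} (U : ι → X.Opens) (V : X.Opens) (hV : V ≤ iSup U)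
    (s t : Γ(X, V))
    (h : ∀ i, res (inf_le_left : V ⊓ U i ≤ V) s = res (inf_le_left : V ⊓ U i ≤ V) t) : s = t :=
  (exists_unique_glue U V hV (fun i => res inf_le_left t)
    (fun i j => by rw [res_res, res_res])).unique h (fun _ => rfl)

lemma isSheaf_tangentPresheaf : (tangentPresheaf f).IsSheaf := by
  rw [TopCat.Presheaf.isSheaf_iff_isSheafUniqueGluing]
  intro ι U D hD
  -- the given derivations agree on overlaps
  have hD' : ∀ (i j : ι) (W : X.Opens) (hi : W ≤ U i) (hj : W ≤ U j) (s : Γ(X, W)),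
      (D i).1 ⟨W, hi⟩ s = (D j).1 ⟨W, hj⟩ s := by
    intro i j W hi hj s
    have := hD i j
    exact congrFun (congrFun (congrArg Subtype.val this) ⟨W, le_inf hi hj⟩) s
  have hg : ∀ (V : {V : X.Opens // V ≤ iSup U}) (s : Γ(X, V.1)), ∃! r : Γ(X, V.1), ∀ i,
      res (inf_le_left : V.1 ⊓ U i ≤ V.1) r = (D i).1 ⟨V.1 ⊓ U i, inf_le_right⟩
        (res inf_le_left s) := by
    intro V s
    refine exists_unique_glue U V.1 V.2 _ fun i j => ?_
    rw [(D i).2.2.2.2 ⟨V.1 ⊓ U i, inf_le_right⟩ ⟨V.1 ⊓ (U i ⊓ U j), _⟩,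
      (D j).2.2.2.2 ⟨V.1 ⊓ U j, inf_le_right⟩ ⟨V.1 ⊓ (U i ⊓ U j), _⟩, res_res, res_res]
    · exact hD' i j _ _ _ _
    · exact inf_le_right.trans inf_le_right
    · exact inf_le_right.trans inf_le_left
  choose E hE hEu using hg
  have hEmem : E ∈ tangentSections f (iSup U) := by
    refine ⟨fun V s t => ?_, fun V s t => ?_, fun V c => ?_, fun V W h s => ?_⟩
    · refine eq_of_res_eq U V.1 V.2 _ _ fun i => ?_
      rw [hE, map_add, map_add, hE, hE, (D i).2.1]
    · refine eq_of_res_eq U V.1 V.2 _ _ fun i => ?_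
      rw [hE, map_mul, map_add, map_mul, map_mul, hE, hE, (D i).2.2.1]
    · refine eq_of_res_eq U V.1 V.2 _ _ fun i => ?_
      rw [hE, res_scalar, (D i).2.2.2.1, map_zero]
    · refine eq_of_res_eq U W.1 W.2 _ _ fun i => ?_
      have h' : W.1 ⊓ U i ≤ V.1 ⊓ U i := inf_le_inf_right _ h
      rw [hE, res_res, res_res]
      have := congrArg (res h') (hE V s i)
      rw [res_res, (D i).2.2.2.2 ⟨V.1 ⊓ U i, inf_le_right⟩ ⟨W.1 ⊓ U i, inf_le_right⟩,
        res_res] at this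
      exact this
  refine ⟨(⟨E, hEmem⟩ : tangentSections f (iSup U)), ?_, ?_⟩
  · intro i
    refine Subtype.ext ?_
    funext V s
    change E ⟨V.1, _⟩ s = (D i).1 V s
    have hVU : V.1 ≤ iSup U := V.2.trans (le_iSup U i)
    have := hE ⟨V.1, hVU⟩ s i
    have h' : V.1 ≤ V.1 ⊓ U i := le_inf le_rfl V.2
    have := congrArg (res h') this
    rw [res_res, res_self, (D i).2.2.2.2 ⟨V.1 ⊓ U i, inf_le_right⟩ V, res_res, res_self] at this
    exact this
  · intro E' hE'
    refine Subtype.ext ?_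
    funext V s
    refine hEu V s _ fun i => ?_
    have h4 := (E' : tangentSections f (iSup U)).2.2.2.2 V
      ⟨V.1 ⊓ U i, inf_le_left.trans V.2⟩ inf_le_left s
    refine h4.trans ?_
    have := hE' i
    exact congrFun (congrFun (congrArg Subtype.val this) ⟨V.1 ⊓ U i, inf_le_right⟩) _

/-- The tangent sheaf `T_X = 𝓗om(Ω¹_{X/k}, 𝒪_X) = 𝓓er_k(𝒪_X, 𝒪_X)` of `X` over `k`. -/
def tangentSheaf : X.Modules where
  val := PresheafOfModules.ofPresheaf (R := X.ringCatSheaf.obj) (tangentPresheaf f) (by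
    intro U V i a D
    refine Subtype.ext ?_
    funext W s
    exact congrArg (fun r => r * (D : tangentSections f U.unop).1 ⟨W.1, W.2.trans (leOfHom i.unop)⟩ s)
      (res_res (leOfHom i.unop) W.2 (a : Γ(X, U.unop))).symm)
  isSheaf := isSheaf_tangentPresheaf f

end Tangent
section Cohomology

variable {k : Type u} [Field k] {X : Scheme.{u}} (f : X ⟶ Spec (.of k)) (M : X.Modules)

/-- The sections `Γ(U, M)` of an `𝒪_X`-module, regarded as a vector space over `k`. -/
def Sec (_ : X ⟶ Spec (.of k)) (M : X.Modules) (U : X.Opens) : Type u := Γ(M, U)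

instance (U : X.Opens) : AddCommGroup (Sec f M U) := inferInstanceAs (AddCommGroup Γ(M, U))

instance (U : X.Opens) : Module k (Sec f M U) :=
  Module.compHom (R := Γ(X, U)) Γ(M, U) (scalar f U)

/-- Restriction of sections from `U` to `V ⊆ U`. -/
def secRes {U V : X.Opens} (h : V ≤ U) : Sec f M U →ₗ[k] Sec f M V where
  toFun s := M.presheaf.map (homOfLE h).op s
  map_add' s t := map_add (M.presheaf.map (homOfLE h).op).hom s t
  map_smul' c s := by
    refine (Scheme.Modules.map_smul M (homOfLE h) (scalar f U c) s).trans ?_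
    exact congrArg (fun r : Γ(X, V) => r • (M.presheaf.map (homOfLE h).op s : Γ(M, V)))
      (res_scalar f h c)

/-- The Čech differential `(s_U) ↦ (s_V - s_U)` on `U ∩ V`, for the cover of `X` by all its affine
open subschemes. -/
def cechD0 : (∀ U : X.affineOpens, Sec f M U) →ₗ[k]
    (∀ p : X.affineOpens × X.affineOpens, Sec f M (p.1 ⊓ p.2)) :=
  LinearMap.pi fun p =>
    secRes f M inf_le_right ∘ₗ LinearMap.proj p.2 - secRes f M inf_le_left ∘ₗ LinearMap.proj p.1

/-- The Čech differential `(g_{UV}) ↦ (g_{VW} - g_{UW} + g_{UV})` on `U ∩ V ∩ W`, for the cover of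
`X` by all its affine open subschemes. -/
def cechD1 : (∀ p : X.affineOpens × X.affineOpens, Sec f M (p.1 ⊓ p.2)) →ₗ[k]
    (∀ t : X.affineOpens × X.affineOpens × X.affineOpens, Sec f M (t.1 ⊓ (t.2.1 ⊓ t.2.2))) :=
  LinearMap.pi fun t =>
    secRes f M (inf_le_right : t.1.1 ⊓ (t.2.1.1 ⊓ t.2.2.1) ≤ t.2.1.1 ⊓ t.2.2.1) ∘ₗ
        LinearMap.proj (t.2.1, t.2.2)
      - secRes f M (le_inf inf_le_left (inf_le_right.trans inf_le_right) :
          t.1.1 ⊓ (t.2.1.1 ⊓ t.2.2.1) ≤ t.1.1 ⊓ t.2.2.1) ∘ₗ LinearMap.proj (t.1, t.2.2)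
      + secRes f M (le_inf inf_le_left (inf_le_right.trans inf_le_left) :
          t.1.1 ⊓ (t.2.1.1 ⊓ t.2.2.1) ≤ t.1.1 ⊓ t.2.1.1) ∘ₗ LinearMap.proj (t.1, t.2.1)

/-- The first Čech cohomology group of a quasi-coherent sheaf on a separated scheme, computed on
the cover by all affine open subschemes. -/
abbrev CechH1 : Type u :=
  LinearMap.ker (cechD1 f M) ⧸
    (LinearMap.range (cechD0 f M)).submoduleOf (LinearMap.ker (cechD1 f M))

/-- The Euler characteristic `χ(M) = dim_k H⁰(X, M) - dim_k H¹(X, M)` of a coherent sheaf on a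
complete curve over `k` (the higher cohomology of a curve vanishes). -/
def eulerChar : ℤ :=
  (Module.finrank k (Sec f M ⊤) : ℤ) - (Module.finrank k (CechH1 f M) : ℤ)

end Cohomology

section Slope

variable {k : Type u} [Field k] {C : Scheme.{u}} (f : C ⟶ Spec (.of k)) [IsIntegral C]

/-- The stalk of an `𝒪_X`-module at `x` is a module over the local ring at `x`. -/
instance stalkModule {X : Scheme.{u}} (M : X.Modules) (x : X) :
    Module (X.presheaf.stalk x) (M.presheaf.stalk x) :=
  let N : PresheafOfModules.{u} (X.presheaf ⋙ forget₂ CommRingCat RingCat) := M.val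
  inferInstanceAs (Module (X.presheaf.stalk x) (TopCat.Presheaf.stalk (C := Ab.{u}) N.presheaf x))

/-- The rank of a coherent sheaf on an integral scheme: the dimension of its generic stalk over the
function field. -/
def sheafRank (M : C.Modules) : ℕ :=
  Module.finrank C.functionField (M.presheaf.stalk (genericPoint C))

/-- The degree `deg M = χ(M) - rk(M) χ(𝒪_C)` of a coherent sheaf on a smooth projective curve. -/
def degree (M : C.Modules) : ℤ :=
  eulerChar f M - sheafRank M * eulerChar f (SheafOfModules.unit C.ringCatSheaf : C.Modules)

/-- The slope `μ(M) = deg M / rk M`, with the convention `μ(M) = ∞` for torsion `M`. -/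
def slope (M : C.Modules) : EReal :=
  if sheafRank M = 0 then ⊤ else (((degree f M : ℝ) / (sheafRank M : ℝ) : ℝ) : EReal)

/-- The minimal slope: the infimum of the slopes of all coherent quotients of `M`. -/
def minSlope (M : C.Modules) : EReal :=
  ⨅ (H : C.Modules) (q : M ⟶ H) (_ : Epi q)
    (_ : SheafOfModules.IsFinitePresentation (R := C.ringCatSheaf) H), slope f H

end Slope

section Frobenius

/-- The `p`-th power map, as a ring endomorphism of a commutative ring in which `p = 0`. -/
def powHom (R : Type u) [CommRing R] (p : ℕ) (hp : p.Prime) (h : (p : R) = 0) : R →+* R where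
  toFun x := x ^ p
  map_one' := one_pow p
  map_mul' x y := mul_pow x y p
  map_zero' := zero_pow hp.ne_zero
  map_add' x y := by
    obtain ⟨r, hr⟩ := exists_add_pow_prime_eq hp x y
    rw [hr, h]
    ring

lemma natCast_eq_zero {k : Type u} [Field k] {X : Scheme.{u}} (f : X ⟶ Spec (.of k)) {p : ℕ}
    (h : (p : k) = 0) (U : X.Opens) : (p : Γ(X, U)) = 0 := by
  rw [← map_natCast (scalar f U) p, h, map_zero]

variable {k : Type u} [Field k] {X : Scheme.{u}} (f : X ⟶ Spec (.of k))

/-- The absolute Frobenius morphism of a scheme over a field of characteristic `p`, as a morphism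
of presheafed spaces: the identity on the underlying space, and `s ↦ s ^ p` on functions. -/
def frobeniusPresheafed (p : ℕ) (hp : p.Prime) (h : (p : k) = 0) :
    X.toPresheafedSpace ⟶ X.toPresheafedSpace where
  base := 𝟙 _
  c :=
    { app U := CommRingCat.ofHom (powHom Γ(X, U.unop) p hp (natCast_eq_zero f h U.unop))
      naturality U V i := by
        ext s
        exact (map_pow (X.presheaf.map i).hom s p).symm }

/-- The absolute Frobenius morphism of a scheme over a field of characteristic `p`. -/
def absoluteFrobenius (p : ℕ) (hp : p.Prime) (h : (p : k) = 0) : X ⟶ X :=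
  ⟨⟨frobeniusPresheafed f p hp h, fun x => by
    refine ⟨fun a ha => ?_⟩
    obtain ⟨U, hxU, s, rfl⟩ := X.presheaf.exists_germ_eq (C := CommRingCat) a
    have key : (PresheafedSpace.Hom.stalkMap (frobeniusPresheafed f p hp h) x).hom
        (X.presheaf.germ U x hxU s) = (X.presheaf.germ U x hxU s) ^ p := by
      have := PresheafedSpace.stalkMap_germ_apply (frobeniusPresheafed f p hp h) U x hxU s
      exact this.trans (map_pow (X.presheaf.germ U x hxU).hom s p)
    have ha' : IsUnit ((X.presheaf.germ U x hxU s) ^ p) := key ▸ ha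
    exact (isUnit_pow_iff hp.ne_zero).1 ha'⟩⟩

/-- The iterates `F^e` of the absolute Frobenius morphism. -/
def frobeniusIter (p : ℕ) (hp : p.Prime) (h : (p : k) = 0) : ℕ → (X ⟶ X)
  | 0 => 𝟙 X
  | e + 1 => absoluteFrobenius f p hp h ≫ frobeniusIter p hp h e

end Frobenius

section Seshadri

variable {k : Type u} [Field k]

lemma ringChar_prime (h : ringChar k ≠ 0) : (ringChar k).Prime :=
  (CharP.char_is_prime_or_zero k (ringChar k)).resolve_right h

/-- The invariant `μ̄_min` of a coherent sheaf on a smooth projective curve over `k`: the minimal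
slope in characteristic `0`, and `lim_e μ_min((F^e)^* M) / p^e` in characteristic `p`. The sequence
is non-increasing, so that its limit exists in `[-∞, ∞]` and equals its lower limit. -/
def minSlopeBar {C : Scheme.{u}} (f : C ⟶ Spec (.of k)) [IsIntegral C] (M : C.Modules) : EReal :=
  if h : ringChar k = 0 then minSlope f M
  else Filter.liminf (fun e : ℕ =>
    minSlope f ((Scheme.Modules.pullback
      (frobeniusIter f (ringChar k) (ringChar_prime h) (ringChar.Nat.cast_ringChar) e)).obj M) /
      (((ringChar k : ℝ) ^ e : ℝ) : EReal)) Filter.atTop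

/-- `ν : C' → C` is the normalization of the integral scheme `C`. -/
structure IsNormalization {C' C : Scheme.{u}} (ν : C' ⟶ C) : Prop where
  isIntegral : IsIntegral C'
  isIntegrallyClosed : ∀ x : C', IsIntegrallyClosed (C'.presheaf.stalk x)
  isFinite : IsFinite ν
  birational : ∃ U : C.Opens, (U : Set C).Nonempty ∧ IsIso (ν ∣_ U)

/-- An irreducible (and reduced, closed) curve `C ⊆ X` passing through the point `p`, together with
its normalization `ν : C' → C`. -/
structure CurveThrough (X : Scheme.{u}) (p : X) where
  /-- the curve -/
  C : Scheme.{u}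
  /-- the inclusion of the curve -/
  ι : C ⟶ X
  isClosedImmersion : IsClosedImmersion ι
  isIntegral : IsIntegral C
  dim_eq_one : topologicalKrullDim C = 1
  /-- the point `p`, as a point of the curve -/
  pt : C
  ι_pt : ι pt = p
  /-- the normalized curve -/
  C' : Scheme.{u}
  /-- the normalization morphism -/
  ν : C' ⟶ C
  isNormalization : IsNormalization ν

instance {X : Scheme.{u}} {p : X} (γ : CurveThrough X p) : IsIntegral γ.C' :=
  γ.isNormalization.isIntegral

/-- The (Hilbert–Samuel) multiplicity of a one-dimensional Noetherian local ring `R` with maximal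
ideal `𝔪`: the limit of `length(R / 𝔪ⁿ) / n`. -/
def multiplicity (R : Type u) [CommRing R] [IsLocalRing R] : ENNReal :=
  Filter.liminf (fun n : ℕ =>
    ((Module.length R (R ⧸ IsLocalRing.maximalIdeal R ^ n) : ℕ∞) : ENNReal) / (n : ENNReal))
    Filter.atTop

/-- The multiplicity `mult_p(C)` of the curve at the point `p`. -/
def CurveThrough.mult {X : Scheme.{u}} {p : X} (γ : CurveThrough X p) : ENNReal :=
  multiplicity (γ.C.presheaf.stalk γ.pt)

/-- The Seshadri constant `ε(X, F; p)` of a coherent sheaf `F` on a complete variety `X` over `k`: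
the infimum of `μ̄_min(ν^* F) / mult_p(C)` over all irreducible curves `C ⊆ X` through `p`, where
`ν` is the normalization of `C`. -/
def seshadriConstant {X : Scheme.{u}} (f : X ⟶ Spec (.of k)) (F : X.Modules) (p : X) : EReal :=
  ⨅ γ : CurveThrough X p,
    minSlopeBar (γ.ν ≫ γ.ι ≫ f) ((Scheme.Modules.pullback (γ.ν ≫ γ.ι)).obj F) / (γ.mult : EReal)

end Seshadri

section QFactorial

/-- `X` is a `ℚ`-factorial variety: it is integral, Noetherian and normal, and for every Weil
divisor `D` some positive multiple `m D` is Cartier, i.e. locally the divisor of a rational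
function. -/
def IsQFactorial (X : Scheme.{u}) : Prop :=
  ∃ (_ : IsIntegral X) (_ : IsNoetherian X),
    (∀ x : X, IsIntegrallyClosed (X.presheaf.stalk x)) ∧
    ∀ D : X →₀ ℤ, (∀ z ∈ D.support, Order.coheight z = 1) →
      ∃ m : ℕ, 0 < m ∧ ∀ x : X, ∃ U : X.Opens, x ∈ U ∧ ∃ g : X.functionField, g ≠ 0 ∧
        ∀ z ∈ U, Scheme.ord g z = m * D z

end QFactorial

end ToricSeshadri

end

/-!
The tangent sheaf of a toric variety has many global sections: for a basis of `N`, the invariant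
derivations `χ^m ↦ m_i χ^m` of `k[M]` preserve every `k[σ^∨ ∩ M]`, hence are global vector fields,
and over the torus they generate the tangent sheaf (`isGeneratedOver_tangentSheaf`). A curve through
`1` meets the torus. So the pullback of the tangent sheaf to the normalization of the curve, all its
Frobenius pullbacks, and all quotients `H` of these are generated by finitely many global sections
on a nonempty open set (`IsGeneratedOver.pullback`, `IsGeneratedOver.of_epi`).

It remains to see that such an `H` has nonnegative degree (`LocallySpan.degree_nonneg`). If `H` has
rank `r`, then `r` of the sections form a basis of `H` at the generic point
(`LocallySpan.exists_generic_basis`), and they define an injection `𝒪ʳ → H` whose cokernel is a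
skyscraper sheaf. Therefore `H⁰(𝒪)ʳ → H⁰(H)` is injective and `H¹(𝒪)ʳ → H¹(H)` is surjective, so that
`χ(H) ≥ r χ(𝒪)`. The Čech groups are taken for the cover by all affine open sets, and surjectivity
on `H¹` is proved by hand: the values of a Čech cocycle of `H` are moved into the image of `𝒪ʳ` by a
coboundary, which exists because sections of `H` can be prescribed modulo the image of `𝒪ʳ` at the
finitely many points of an affine open set where this image differs from `H`
(`LocallySpan.exists_approximation`, an application of the Chinese remainder theorem).

Finite-dimensionality of the cohomology groups is not needed. The injection on `H⁰` has a cokernel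
and the surjection on `H¹` has a kernel of finite dimension, so if one of the two spaces has infinite
dimension, then so has the other (unless `r = 0`), and the inequalities hold between the values `0`
that `Module.finrank` takes (`card_mul_finrank_le`, `finrank_le_card_mul`).
-/

noncomputable section

namespace ToricSeshadri

/-! ### Epimorphisms of sheaves of modules -/

section SheafOfModulesEpi

/-- Epimorphisms of sheaves remain epimorphisms when sheafified again as presheaves; this holds for
every reflective subcategory. -/
lemma epi_map_map_of_adjunction {A B : Type*} [Category A] [Category B] {F : A ⥤ B} {G : B ⥤ A}
    (adj : F ⊣ G) [IsIso adj.counit] {M N : B} (φ : M ⟶ N) [Epi φ] : Epi (F.map (G.map φ)) := by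
  have h2 : F.map (G.map φ) = (adj.counit.app M ≫ φ) ≫ inv (adj.counit.app N) := by
    rw [IsIso.eq_comp_inv]
    exact adj.counit.naturality φ
  rw [h2]
  infer_instance

/-- A morphism of presheaves of modules whose sheafification is an epimorphism is locally
surjective: its presheaf image becomes an isomorphism after sheafification. -/
lemma isLocallySurjective_of_epi_sheafification {X : Scheme.{u}}
    {M N : PresheafOfModules.{u} X.ringCatSheaf.obj} (ψ : M ⟶ N)
    [Epi ((PresheafOfModules.sheafification.{u} (J := Opens.grothendieckTopology X)
      (R := X.ringCatSheaf) (𝟙 X.ringCatSheaf.obj)).map ψ)] :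
    Presheaf.IsLocallySurjective (Opens.grothendieckTopology X)
      ((PresheafOfModules.toPresheaf _).map ψ) := by
  let J := Opens.grothendieckTopology X
  let a := PresheafOfModules.sheafification.{u} (J := J) (R := X.ringCatSheaf)
    (𝟙 X.ringCatSheaf.obj)
  let e := Abelian.factorThruImage ψ
  let m := Abelian.image.ι ψ
  have hem : e ≫ m = ψ := Abelian.image.fac ψ
  have hm : Epi (a.map m) := by
    have : Epi (a.map e ≫ a.map m) := by
      rw [← a.map_comp, hem]
      infer_instance
    exact epi_of_epi (a.map e) _
  have hm' : Mono (a.map m) := inferInstance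
  have hiso : IsIso (a.map m) := isIso_of_mono_of_epi _
  have hW : J.W ((PresheafOfModules.toPresheaf _).map m) := by
    rw [GrothendieckTopology.W_iff]
    exact inferInstanceAs (IsIso ((SheafOfModules.toSheaf X.ringCatSheaf).map (a.map m)))
  have h1 : Presheaf.IsLocallySurjective J ((PresheafOfModules.toPresheaf _).map m) :=
    ((GrothendieckTopology.W_iff_isLocallyBijective _ _).1 hW).2
  have h2 : Presheaf.IsLocallySurjective J ((PresheafOfModules.toPresheaf _).map e) := by
    apply Presheaf.isLocallySurjective_of_surjective
    intro U
    exact PresheafOfModules.surjective_of_epi e U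
  rw [← hem, Functor.map_comp]
  exact Presheaf.isLocallySurjective_comp _ _ _

/-- An epimorphism of sheaves of modules is locally surjective on sections. -/
lemma exists_app_eq_of_epi {X : Scheme.{u}} {M N : X.Modules} (φ : M ⟶ N) [Epi φ]
    (U : X.Opens) (t : Γ(N, U)) (x : X) (hx : x ∈ U) :
    ∃ (V : X.Opens) (h : V ≤ U) (_ : x ∈ V) (s : Γ(M, V)),
      φ.app V s = N.presheaf.map (homOfLE h).op t := by
  have hφ : Epi (C := SheafOfModules.{u} X.ringCatSheaf) φ := ‹Epi φ›
  have h1 := epi_map_map_of_adjunction (PresheafOfModules.sheafificationAdjunction.{u}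
    (J := Opens.grothendieckTopology X) (R := X.ringCatSheaf) (𝟙 X.ringCatSheaf.obj))
    (M := M) (N := N) φ
  have := @isLocallySurjective_of_epi_sheafification X _ _ _ h1
  obtain ⟨V, hV, ⟨s, hs⟩, hxV⟩ := (TopCat.Presheaf.isLocallySurjective_iff
    ((PresheafOfModules.toPresheaf _).map φ.val)).1 this U t x hx
  exact ⟨V, hV, hxV, s, hs⟩

end SheafOfModulesEpi

/-! ### Sheaves generated over an open subset -/

section Generated

/-- A family of morphisms `A → M` is jointly epimorphic if a morphism out of `M` is determined by
its composites with the members of the family. -/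
def IsJointlyEpi {𝒞 : Type*} [Category 𝒞] {ι : Type*} {A M : 𝒞} (σ : ι → (A ⟶ M)) : Prop :=
  ∀ ⦃N : 𝒞⦄ (a b : M ⟶ N), (∀ i, σ i ≫ a = σ i ≫ b) → a = b

namespace IsJointlyEpi

variable {𝒞 𝒟 : Type*} [Category 𝒞] [Category 𝒟] {ι : Type*} {A B M N : 𝒞} {σ : ι → (A ⟶ M)}

lemma comp_epi (h : IsJointlyEpi σ) (q : M ⟶ N) [Epi q] : IsJointlyEpi fun i => σ i ≫ q := by
  intro N' a b hab
  rw [← cancel_epi q]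
  exact h _ _ fun i => by simpa using hab i

lemma epi_comp (h : IsJointlyEpi σ) (e : B ⟶ A) [Epi e] : IsJointlyEpi fun i => e ≫ σ i := by
  intro N' a b hab
  refine h _ _ fun i => ?_
  rw [← cancel_epi e]
  simpa using hab i

lemma map (h : IsJointlyEpi σ) (F : 𝒞 ⥤ 𝒟) [F.IsLeftAdjoint] :
    IsJointlyEpi fun i => F.map (σ i) := by
  intro N' a b hab
  apply ((Adjunction.ofIsLeftAdjoint F).homEquiv _ _).injective
  refine h _ _ fun i => ?_
  rw [← Adjunction.homEquiv_naturality_left, ← Adjunction.homEquiv_naturality_left, hab i]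

lemma of_natIso {F G : 𝒞 ⥤ 𝒟} (e : F ≅ G) (h : IsJointlyEpi fun i => F.map (σ i)) :
    IsJointlyEpi fun i => G.map (σ i) := by
  have := (h.comp_epi (e.hom.app M)).epi_comp (e.inv.app A)
  simpa using this

lemma epi_desc [Preadditive 𝒞] [HasFiniteBiproducts 𝒞] [Finite ι] (h : IsJointlyEpi σ) :
    Epi (biproduct.desc σ) where
  left_cancellation a b hab := h a b fun i => by
    simpa using congrArg (fun f => biproduct.ι (fun _ => A) i ≫ f) hab

end IsJointlyEpi

variable {X Y : Scheme.{u}}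

variable (X) in
/-- The structure sheaf, as a sheaf of modules over itself. -/
def structureModule : X.Modules := (SheafOfModules.unit X.ringCatSheaf : X.Modules)

/-- A morphism out of the structure module is determined by the image of `1`. -/
lemma structureModule_app_apply {M : X.Modules} (σ : structureModule X ⟶ M) (U : X.Opens)
    (a : Γ(X, U)) :
    σ.app U (show Γ(structureModule X, U) from a) =
      a • M.presheaf.map (homOfLE le_top).op
        (σ.app ⊤ (show Γ(structureModule X, ⊤) from (1 : Γ(X, ⊤)))) := by
  have h1 : (show Γ(structureModule X, U) from a) =
      a • (show Γ(structureModule X, U) from (1 : Γ(X, U))) := (mul_one a).symm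
  rw [h1, Scheme.Modules.Hom.app_smul]
  congr 1
  have h2 : (show Γ(structureModule X, U) from (1 : Γ(X, U))) =
      (structureModule X).presheaf.map (homOfLE le_top).op
        (show Γ(structureModule X, ⊤) from (1 : Γ(X, ⊤))) :=
    (map_one (X.presheaf.map (homOfLE (le_top : U ≤ ⊤)).op).hom).symm
  rw [h2]
  exact ConcreteCategory.congr_hom (σ.mapPresheaf.naturality (homOfLE (le_top : U ≤ ⊤)).op) _

/-- The restriction of the sheaf of modules `M` to the open set `U` is generated by finitely many
sections of `M` over the whole scheme. -/
def IsGeneratedOver (M : X.Modules) (U : X.Opens) : Prop :=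
  ∃ (n : ℕ) (σ : Fin n → (structureModule X ⟶ M)),
    IsJointlyEpi fun i => (Scheme.Modules.restrictFunctor U.ι).map (σ i)

lemma IsGeneratedOver.of_epi {M H : X.Modules} {U : X.Opens} (h : IsGeneratedOver M U)
    (q : M ⟶ H) [Epi q] : IsGeneratedOver H U := by
  obtain ⟨n, σ, hσ⟩ := h
  refine ⟨n, fun i => σ i ≫ q, ?_⟩
  simpa using hσ.comp_epi ((Scheme.Modules.restrictFunctor U.ι).map q)

lemma isIso_pullbackObjUnitToUnit {𝒞 𝒟 : Type*} [Category 𝒞] [Category 𝒟]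
    {J : GrothendieckTopology 𝒞} {K : GrothendieckTopology 𝒟} {F : 𝒞 ⥤ 𝒟} {S : Sheaf J RingCat.{u}}
    {R : Sheaf K RingCat.{u}} [Functor.IsContinuous F J K]
    (φ : S ⟶ (F.sheafPushforwardContinuous RingCat.{u} J K).obj R)
    [(SheafOfModules.pushforward.{u} φ).IsRightAdjoint] [F.Final] :
    IsIso (SheafOfModules.pullbackObjUnitToUnit φ) :=
  inferInstance

/-- The pullback of the structure sheaf is the structure sheaf. -/
def pullbackStructureModule (g : Y ⟶ X) :
    (Scheme.Modules.pullback g).obj (structureModule X) ≅ structureModule Y :=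
  have : (SheafOfModules.pushforward.{u} g.toRingCatSheafHom).IsRightAdjoint :=
    inferInstanceAs (Scheme.Modules.pushforward g).IsRightAdjoint
  have : (TopologicalSpace.Opens.map g.base).Final :=
    Functor.final_of_exists_of_isFiltered _ (fun _ => ⟨⊤, ⟨homOfLE le_top⟩⟩)
      (fun _ _ => ⟨_, 𝟙 _, Subsingleton.elim _ _⟩)
  have h := isIso_pullbackObjUnitToUnit g.toRingCatSheafHom
  @asIso (SheafOfModules Y.ringCatSheaf) _ _ _
    (SheafOfModules.pullbackObjUnitToUnit g.toRingCatSheafHom) h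

lemma IsGeneratedOver.pullback {M : X.Modules} {U : X.Opens} (h : IsGeneratedOver M U)
    (g : Y ⟶ X) : IsGeneratedOver ((Scheme.Modules.pullback g).obj M) (g ⁻¹ᵁ U) := by
  obtain ⟨n, σ, hσ⟩ := h
  refine ⟨n, fun i => (pullbackStructureModule g).inv ≫ (Scheme.Modules.pullback g).map (σ i), ?_⟩
  have h1 := hσ.map (Scheme.Modules.pullback (g ∣_ U))
  let e : Scheme.Modules.restrictFunctor U.ι ⋙ Scheme.Modules.pullback (g ∣_ U) ≅
      Scheme.Modules.pullback g ⋙ Scheme.Modules.restrictFunctor (g ⁻¹ᵁ U).ι :=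
    Functor.isoWhiskerRight (Scheme.Modules.restrictFunctorIsoPullback U.ι) _ ≪≫
      Scheme.Modules.pullbackComp _ _ ≪≫
      Scheme.Modules.pullbackCongr (morphismRestrict_ι g U) ≪≫
      (Scheme.Modules.pullbackComp _ _).symm ≪≫
      Functor.isoWhiskerLeft _ (Scheme.Modules.restrictFunctorIsoPullback (g ⁻¹ᵁ U).ι).symm
  have h2 := IsJointlyEpi.of_natIso (σ := σ) e h1
  have h3 := h2.epi_comp ((Scheme.Modules.restrictFunctor (g ⁻¹ᵁ U).ι).map
    (pullbackStructureModule g).inv)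
  simpa using h3

end Generated

/-! ### Sections of sheaves of modules -/

section ModuleSections

variable {X : Scheme.{u}}

/-- Restriction of sections of a sheaf of modules from `U` to `V ⊆ U`. -/
def modRes (M : X.Modules) {U V : X.Opens} (h : V ≤ U) : Γ(M, U) →+ Γ(M, V) :=
  (M.presheaf.map (homOfLE h).op).hom

variable {M N : X.Modules}

lemma modRes_modRes {U V W : X.Opens} (h : V ≤ U) (h' : W ≤ V) (s : Γ(M, U)) :
    modRes M h' (modRes M h s) = modRes M (h'.trans h) s := by
  simp only [modRes]
  rw [← AddCommGrpCat.comp_apply, ← Functor.map_comp]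
  rfl

lemma modRes_self {U : X.Opens} (s : Γ(M, U)) : modRes M le_rfl s = s := by
  have : M.presheaf.map (homOfLE (le_refl U)).op = 𝟙 _ := M.presheaf.map_id _
  simp only [modRes, this]
  rfl

lemma modRes_smul {U V : X.Opens} (h : V ≤ U) (a : Γ(X, U)) (s : Γ(M, U)) :
    modRes M h (a • s) = res h a • modRes M h s :=
  Scheme.Modules.map_smul M (homOfLE h) a s

lemma modRes_app (φ : M ⟶ N) {U V : X.Opens} (h : V ≤ U) (s : Γ(M, U)) :
    φ.app V (modRes M h s) = modRes N h (φ.app U s) :=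
  ConcreteCategory.congr_hom (φ.mapPresheaf.naturality (homOfLE h).op) s

/-- Sections of a sheaf of modules which agree locally are equal. -/
lemma modRes_ext {U : X.Opens} {s t : Γ(M, U)}
    (h : ∀ x ∈ U, ∃ (V : X.Opens) (hV : V ≤ U), x ∈ V ∧ modRes M hV s = modRes M hV t) :
    s = t := by
  choose V hV hxV hst using h
  refine TopCat.Sheaf.eq_of_locally_eq' ⟨M.presheaf, M.isSheaf⟩
    (fun x : U => V x.1 x.2) U (fun x => homOfLE (hV x.1 x.2)) ?_ s t fun x => hst x.1 x.2
  intro x hx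
  exact TopologicalSpace.Opens.mem_iSup.2 ⟨⟨x, hx⟩, hxV x hx⟩

/-- Functions which agree locally are equal. -/
lemma res_ext {U : X.Opens} {s t : Γ(X, U)}
    (h : ∀ x ∈ U, ∃ (V : X.Opens) (hV : V ≤ U), x ∈ V ∧ res hV s = res hV t) : s = t :=
  modRes_ext (M := structureModule X) (s := s) (t := t) h

/-- The sections `s i` of `M` over `U` generate the sheaf `M` restricted to `U₀`. -/
def LocallySpan {ι : Type*} [Fintype ι] {U : X.Opens} (s : ι → Γ(M, U)) (U₀ : X.Opens) : Prop :=
  ∀ (W : X.Opens) (_ : W ≤ U₀) (t : Γ(M, W)), ∀ x ∈ W, ∃ (V : X.Opens) (hVW : V ≤ W)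
    (hVU : V ≤ U) (a : ι → Γ(X, V)), x ∈ V ∧ modRes M hVW t = ∑ i, a i • modRes M hVU (s i)

lemma IsJointlyEpi.exists_eq_sum {ι : Type} [Fintype ι] {A : X.Modules} {σ : ι → (A ⟶ M)}
    (hσ : IsJointlyEpi σ) (U : X.Opens) (t : Γ(M, U)) (x : X) (hx : x ∈ U) :
    ∃ (V : X.Opens) (h : V ≤ U) (p : ι → Γ(A, V)), x ∈ V ∧
      modRes M h t = ∑ i, (σ i).app V (p i) := by
  classical
  have : HasFiniteBiproducts X.Modules := Abelian.hasFiniteBiproducts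
  have := hσ.epi_desc
  obtain ⟨V, h, hxV, s, hs⟩ := exists_app_eq_of_epi (biproduct.desc σ) U t x hx
  refine ⟨V, h, fun i => (biproduct.π (fun _ => A) i).app V s, hxV, hs.symm.trans ?_⟩
  have h1 : biproduct.desc σ = ∑ i, biproduct.π (fun _ => A) i ≫ σ i := by
    apply biproduct.hom_ext'
    intro j
    simp only [biproduct.ι_desc, Preadditive.comp_sum]
    rw [Finset.sum_eq_single j]
    · simp
    · intro i _ hij
      rw [biproduct.ι_π_ne_assoc _ hij.symm, zero_comp]
    · simp
  have h2 : ∀ (S : Finset ι) (f : ι → (⨁ (fun _ : ι => A) ⟶ M)),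
      (∑ i ∈ S, f i).app V s = ∑ i ∈ S, (f i).app V s := by
    intro S f
    induction S using Finset.induction_on with
    | empty => simp
    | insert a S ha ih => rw [Finset.sum_insert ha, Finset.sum_insert ha, ← ih]; rfl
  rw [h1, h2]
  rfl

lemma IsGeneratedOver.exists_locallySpan {U : X.Opens} (h : IsGeneratedOver M U) :
    ∃ (n : ℕ) (s : Fin n → Γ(M, ⊤)), LocallySpan s U := by
  obtain ⟨n, σ, hσ⟩ := h
  refine ⟨n, fun i => (σ i).app ⊤ (show Γ(structureModule X, ⊤) from (1 : Γ(X, ⊤))),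
    fun W hW t x hx => ?_⟩
  have hle : U.ι ''ᵁ (U.ι ⁻¹ᵁ W) ≤ W := U.ι.image_preimage_le W
  obtain ⟨V, hV, p, hxV, hp⟩ := hσ.exists_eq_sum (U.ι ⁻¹ᵁ W) (modRes M hle t) ⟨x, hW hx⟩ hx
  refine ⟨U.ι ''ᵁ V, (Scheme.Hom.image_mono _ hV).trans hle, le_top, p,
    ⟨⟨x, hW hx⟩, hxV, rfl⟩, ?_⟩
  have h1 : modRes M (Scheme.Hom.image_mono U.ι hV) (modRes M hle t) =
    ∑ i, (σ i).app (U.ι ''ᵁ V) (p i) := hp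
  rw [modRes_modRes] at h1
  rw [h1]
  exact Finset.sum_congr rfl fun i _ => structureModule_app_apply (σ i) _ (p i)

lemma IsJointlyEpi.of_generatingSections {𝒞 : Type*} [Category 𝒞] {J : GrothendieckTopology 𝒞}
    {R : Sheaf J RingCat.{u}} [HasWeakSheafify J AddCommGrpCat.{u}]
    [J.WEqualsLocallyBijective AddCommGrpCat.{u}] {M : SheafOfModules.{u} R}
    (G : M.GeneratingSections) : IsJointlyEpi fun i => M.unitHomEquiv.symm (G.s i) := by
  intro N a b hab
  have := G.epi
  rw [← cancel_epi (M.freeHomEquiv.symm G.s)]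
  refine Cofan.IsColimit.hom_ext (SheafOfModules.isColimitFreeCofan _) _ _ fun i => ?_
  have h1 : SheafOfModules.ιFree i ≫ M.freeHomEquiv.symm G.s = M.unitHomEquiv.symm (G.s i) := by
    rw [← SheafOfModules.unitHomEquiv_symm_freeHomEquiv_apply, Equiv.apply_symm_apply]
  have h2 := hab i
  simp only [← h1, Category.assoc] at h2
  exact h2

lemma structureModule_app_apply_of_restrict {U : X.Opens}
    (σ : structureModule U.toScheme ⟶ M.restrict U.ι) (hU : U ≤ U.ι ''ᵁ ⊤)
    {V : U.toScheme.Opens} (h : U.ι ''ᵁ V ≤ U) (p : Γ(U.toScheme, V)) :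
    (show Γ(M, U.ι ''ᵁ V) from σ.app V (show Γ(structureModule U.toScheme, V) from p)) =
      (U.ι.appIso V).inv p • modRes M h (modRes M hU
        (show Γ(M, U.ι ''ᵁ ⊤) from σ.app ⊤
          (show Γ(structureModule U.toScheme, ⊤) from (1 : Γ(U.toScheme, ⊤))))) := by
  rw [modRes_modRes]
  exact structureModule_app_apply σ V p

/-- A sheaf of modules of finite presentation is generated, on a neighbourhood of every point, by
finitely many sections. -/
lemma exists_locallySpan_of_isFinitePresentation (M : X.Modules)
    [hM : SheafOfModules.IsFinitePresentation (R := X.ringCatSheaf) M] (x : X) :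
    ∃ (U : X.Opens) (_ : x ∈ U) (n : ℕ) (s : Fin n → Γ(M, U)), LocallySpan s U := by
  obtain ⟨⟨I, W, cov, pres⟩, hfin⟩ := hM.exists_quasicoherentData
  rw [Opens.coversTop_iff] at cov
  obtain ⟨i, hi⟩ := TopologicalSpace.Opens.mem_iSup.1
    (cov ▸ TopologicalSpace.Opens.mem_top x : x ∈ iSup W)
  have := (hfin.isFinite_presentation i).isFiniteType_generators
  let G := (pres i).generators
  let U : X.Opens := W i
  have : Finite G.I := this.finite
  have h1 := (IsJointlyEpi.of_generatingSections G).map (Scheme.Modules.overEquiv U).functor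
  have : IsIso ((Scheme.Modules.overFunctorEquiv U).hom.app M) :=
    ((Scheme.Modules.overFunctorEquiv U).app M).isIso_hom
  have : Epi ((Scheme.Modules.overFunctorEquiv U).hom.app M) := IsIso.epi_of_iso _
  have h2 := h1.comp_epi ((Scheme.Modules.overFunctorEquiv U).hom.app M)
  let e : Fin (Nat.card G.I) ≃ G.I := (Finite.equivFin G.I).symm
  let σ : Fin (Nat.card G.I) → (structureModule U.toScheme ⟶ M.restrict U.ι) := fun j =>
    (Scheme.Modules.overEquiv U).functor.map ((M.over U).unitHomEquiv.symm (G.s (e j))) ≫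
      (Scheme.Modules.overFunctorEquiv U).hom.app M
  have hσ : IsJointlyEpi σ := by
    intro N a b hab
    refine h2 a b fun j => ?_
    have := hab (e.symm j)
    simp only [σ, Equiv.apply_symm_apply] at this
    exact this
  have hU : U ≤ U.ι ''ᵁ ⊤ := by simp
  refine ⟨U, hi, Nat.card G.I, fun j => modRes M hU ((σ j).app ⊤
    (show Γ(structureModule U.toScheme, ⊤) from (1 : Γ(U.toScheme, ⊤)))), fun V hV t x hx => ?_⟩
  have hle : U.ι ''ᵁ (U.ι ⁻¹ᵁ V) ≤ V := U.ι.image_preimage_le V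
  obtain ⟨V', hV', p, hxV, hp⟩ := hσ.exists_eq_sum (U.ι ⁻¹ᵁ V) (modRes M hle t) ⟨x, hV hx⟩ hx
  refine ⟨U.ι ''ᵁ V', (Scheme.Hom.image_mono _ hV').trans hle,
    ((Scheme.Hom.image_mono _ hV').trans hle).trans hV,
    fun j => (U.ι.appIso V').inv (show Γ(U.toScheme, V') from p j), ⟨⟨x, hV hx⟩, hxV, rfl⟩, ?_⟩
  have h1 : modRes M (Scheme.Hom.image_mono U.ι hV') (modRes M hle t) =
    ∑ i, (σ i).app V' (p i) := hp
  rw [modRes_modRes] at h1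
  rw [h1]
  refine Finset.sum_congr rfl fun j _ => ?_
  exact structureModule_app_apply_of_restrict (σ j) hU _ (p j)

end ModuleSections

/-! ### Quasi-coherent sheaves on affine open sets -/

section QuasiCoherent

variable {X : Scheme.{u}} {V : X.Opens}

lemma fromSpec_image_le (hV : IsAffineOpen V) (D : (Spec Γ(X, V)).Opens) :
    hV.fromSpec ''ᵁ D ≤ V := by
  rintro _ ⟨y, -, rfl⟩
  exact hV.range_fromSpec.le ⟨y, rfl⟩

/-- Under the isomorphism of `V` with `Spec Γ(X, V)`, scalars in `Γ(X, V)` act through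
restriction. -/
lemma fromSpec_appIso_inv_apply (hV : IsAffineOpen V) (D : (Spec Γ(X, V)).Opens) (r : Γ(X, V)) :
    (hV.fromSpec.appIso D).inv ((Spec Γ(X, V)).presheaf.map D.leTop.op
      ((Scheme.ΓSpecIso Γ(X, V)).inv r)) = res (fromSpec_image_le hV D) r := by
  have h : (Scheme.ΓSpecIso Γ(X, V)).inv ≫ (Spec Γ(X, V)).presheaf.map D.leTop.op ≫
      (hV.fromSpec.appIso D).inv = X.presheaf.map (homOfLE (fromSpec_image_le hV D)).op := by
    rw [← Category.assoc, Iso.comp_inv_eq, Scheme.Hom.appIso_hom', Scheme.Hom.map_appLE,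
      Scheme.Hom.appLE, hV.fromSpec_app_self, Category.assoc, ← Functor.map_comp]
    rfl
  exact congrArg (fun f => f.hom r) h

lemma isLocalizedModule_restrict_fromSpec (M : X.Modules)
    [hM : SheafOfModules.IsQuasicoherent (R := X.ringCatSheaf) M] (hV : IsAffineOpen V)
    (f : Γ(X, V)) :
    IsLocalizedModule (.powers f) ((modulesSpecToSheaf.obj (M.restrict hV.fromSpec)).obj.map
      (PrimeSpectrum.basicOpen f).leTop.op).hom := by
  have : (M.restrict hV.fromSpec).IsQuasicoherent :=
    Scheme.Modules.isQuasicoherent_restrictFunctor hV.fromSpec M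
  exact (isIso_fromTildeΓ_iff_isLocalizing _).1
    (Scheme.Modules.isIso_fromTildeΓ_of_isQuasicoherent _) f

/-- A section of a quasi-coherent sheaf on an affine open set which vanishes on `D(f)` is killed by a
power of `f`. -/
lemma exists_pow_smul_eq_zero (M : X.Modules)
    [hM : SheafOfModules.IsQuasicoherent (R := X.ringCatSheaf) M] (hV : IsAffineOpen V)
    (f : Γ(X, V)) (t : Γ(M, V)) (ht : modRes M (X.basicOpen_le f) t = 0) :
    ∃ k : ℕ, f ^ k • t = 0 := by
  have hloc := isLocalizedModule_restrict_fromSpec M hV f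
  have htop : hV.fromSpec ''ᵁ ⊤ ≤ V := fromSpec_image_le hV ⊤
  have htop' : V ≤ hV.fromSpec ''ᵁ ⊤ := by simp
  let t' : Γ(M.restrict hV.fromSpec, ⊤) := modRes M htop t
  have h0 : ((modulesSpecToSheaf.obj (M.restrict hV.fromSpec)).obj.map
      (PrimeSpectrum.basicOpen f).leTop.op).hom t' = 0 := by
    have hle : hV.fromSpec ''ᵁ (PrimeSpectrum.basicOpen f) ≤ X.basicOpen f :=
      (hV.fromSpec_image_basicOpen f).le
    have : modRes M (Scheme.Hom.image_mono hV.fromSpec (PrimeSpectrum.basicOpen f).leTop.le)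
        (modRes M htop t) = 0 := by
      rw [modRes_modRes, ← modRes_modRes (X.basicOpen_le f) hle, ht, map_zero]
    exact this
  obtain ⟨⟨_, k, rfl⟩, hk⟩ := (IsLocalizedModule.eq_zero_iff (.powers f) _).1 h0
  refine ⟨k, ?_⟩
  have hk' : res htop (f ^ k) • modRes M htop t = 0 := by
    rw [← fromSpec_appIso_inv_apply]
    exact hk
  rw [← modRes_smul] at hk'
  have := congrArg (modRes M htop') hk'
  rwa [modRes_modRes, modRes_self, map_zero] at this

/-- A section of a quasi-coherent sheaf on `D(f)` extends after multiplication by a power of `f`. -/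
lemma exists_modRes_eq_pow_smul (M : X.Modules)
    [hM : SheafOfModules.IsQuasicoherent (R := X.ringCatSheaf) M] (hV : IsAffineOpen V)
    (f : Γ(X, V)) (t : Γ(M, X.basicOpen f)) :
    ∃ (k : ℕ) (n : Γ(M, V)), modRes M (X.basicOpen_le f) n = res (X.basicOpen_le f) f ^ k • t := by
  have hloc := isLocalizedModule_restrict_fromSpec M hV f
  have htop' : V ≤ hV.fromSpec ''ᵁ ⊤ := by simp
  let D : (Spec Γ(X, V)).Opens := PrimeSpectrum.basicOpen f
  have hle : hV.fromSpec ''ᵁ D ≤ X.basicOpen f := (hV.fromSpec_image_basicOpen f).le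
  have hle' : X.basicOpen f ≤ hV.fromSpec ''ᵁ D := (hV.fromSpec_image_basicOpen f).ge
  let t' : Γ(M.restrict hV.fromSpec, D) := modRes M hle t
  obtain ⟨⟨n, ⟨_, k, rfl⟩⟩, hn⟩ := hloc.surj t'
  let n' : Γ(M, hV.fromSpec ''ᵁ ⊤) := n
  have hn' : res (fromSpec_image_le hV D) (f ^ k) • modRes M hle t =
      modRes M (Scheme.Hom.image_mono hV.fromSpec D.leTop.le) n' :=
    (congrArg (fun r => r • modRes M hle t)
      (fromSpec_appIso_inv_apply hV D (f ^ k))).symm.trans hn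
  refine ⟨k, modRes M htop' n', ?_⟩
  have := congrArg (modRes M hle') hn'
  rw [modRes_smul, modRes_modRes, modRes_self, modRes_modRes, res_res, map_pow] at this
  rw [modRes_modRes, this]

end QuasiCoherent

/-! ### Local inverses and the affine local-to-global principle -/

section ArtinianQuotient

/-- An Artinian ring is the product of its localizations. Hence, given denominators `h p`, there
are elements `c P` of `A` which agree modulo `I` with `1 / h P` at the prime `P` and with `0` at the
other primes containing `I`. -/
lemma exists_local_inverses {A : Type*} [CommRing A] (I : Ideal A) [IsArtinianRing (A ⧸ I)]
    (h : PrimeSpectrum A → A) (hh : ∀ p, h p ∉ p.asIdeal) :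
    ∃ c : PrimeSpectrum (A ⧸ I) → A, ∀ P : PrimeSpectrum (A ⧸ I),
      ∃ v ∉ (PrimeSpectrum.comap (Ideal.Quotient.mk I) P).asIdeal,
        v * (h (PrimeSpectrum.comap (Ideal.Quotient.mk I) P) * c P - 1) ∈ I ∧
        ∀ Q ≠ P, v * c Q ∈ I := by
  classical
  let π := Ideal.Quotient.mk I
  have hbij := PrimeSpectrum.toPiLocalization_bijective (R := A ⧸ I)
  have hunit : ∀ P : PrimeSpectrum (A ⧸ I), IsUnit (algebraMap (A ⧸ I)
      (Localization P.asIdeal.primeCompl) (π (h (PrimeSpectrum.comap π P)))) := fun P =>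
    IsLocalization.map_units _ (⟨_, hh (PrimeSpectrum.comap π P)⟩ : P.asIdeal.primeCompl)
  have hc : ∀ P : PrimeSpectrum (A ⧸ I), ∃ c : A, ∀ Q : PrimeSpectrum (A ⧸ I),
      algebraMap (A ⧸ I) (Localization Q.asIdeal.primeCompl) (π c) =
        (Pi.single P ((hunit P).unit⁻¹ : (Localization P.asIdeal.primeCompl)ˣ).1 :
          PrimeSpectrum.PiLocalization (A ⧸ I)) Q := by
    intro P
    obtain ⟨b, hb⟩ := hbij.2 (Pi.single P ((hunit P).unit⁻¹).1)
    obtain ⟨c, rfl⟩ := Ideal.Quotient.mk_surjective b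
    exact ⟨c, fun Q => congrFun hb Q⟩
  choose c hc using hc
  refine ⟨c, fun P => ?_⟩
  have key : ∀ x : A, algebraMap (A ⧸ I) (Localization P.asIdeal.primeCompl) (π x) = 0 →
      ∃ v ∉ (PrimeSpectrum.comap π P).asIdeal, v * x ∈ I := by
    intro x hx
    obtain ⟨⟨m, hm⟩, hmx⟩ := (IsLocalization.map_eq_zero_iff P.asIdeal.primeCompl _ _).1 hx
    obtain ⟨v, rfl⟩ := Ideal.Quotient.mk_surjective m
    refine ⟨v, hm, ?_⟩
    rw [← Ideal.Quotient.eq_zero_iff_mem, map_mul]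
    exact hmx
  have hx : ∀ Q : PrimeSpectrum (A ⧸ I), ∃ v ∉ (PrimeSpectrum.comap π P).asIdeal,
      v * (if Q = P then h (PrimeSpectrum.comap π P) * c P - 1 else c Q) ∈ I := by
    intro Q
    apply key
    split_ifs with hQ
    · have := hc P P
      rw [Pi.single_eq_same] at this
      rw [map_sub, map_mul, map_sub, map_mul, this, map_one, map_one, sub_eq_zero]
      exact (hunit P).mul_val_inv
    · rw [hc Q P, Pi.single_eq_of_ne (Ne.symm hQ)]
  choose v hv hvI using hx
  have : Finite (PrimeSpectrum (A ⧸ I)) := inferInstance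
  let _ := Fintype.ofFinite (PrimeSpectrum (A ⧸ I))
  have hdvd : ∀ Q x, v Q * x ∈ I → (∏ Q, v Q) * x ∈ I := by
    intro Q x hx
    obtain ⟨w, hw⟩ := Finset.dvd_prod_of_mem v (Finset.mem_univ Q)
    rw [hw, mul_right_comm]
    exact I.mul_mem_right _ hx
  refine ⟨∏ Q, v Q, ?_, ?_, fun Q hQ => ?_⟩
  · rw [Ideal.IsPrime.prod_mem_iff]
    push Not
    exact fun Q _ => hv Q
  · exact hdvd P _ (by simpa using hvI P)
  · exact hdvd Q _ (by simpa [hQ] using hvI Q)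

end ArtinianQuotient

section AffineSections

variable {X : Scheme.{u}} {V : X.Opens} (M : X.Modules) {ι : Type*} [Fintype ι]

lemma res_basicOpen_isUnit (f : Γ(X, V)) : IsUnit (res (X.basicOpen_le f) f) :=
  X.toRingedSpace.isUnit_res_basicOpen f

lemma isUnit_res_of_le {W : X.Opens} (hW : W ≤ V) (f : Γ(X, V)) (h : W ≤ X.basicOpen f) :
    IsUnit (res hW f) := by
  have := (res_basicOpen_isUnit f).map (res h)
  rwa [res_res] at this

/-- A function on the basic open set `D(f)` becomes the restriction of a function on `V` after
multiplication by any large power of `f`. -/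
lemma exists_res_eq_pow_mul (hV : IsAffineOpen V) (f : Γ(X, V)) (a : Γ(X, X.basicOpen f)) :
    ∃ k : ℕ, ∀ l, k ≤ l → ∃ b : Γ(X, V),
      res (X.basicOpen_le f) b = res (X.basicOpen_le f) f ^ l * a := by
  have := hV.isLocalization_basicOpen f
  obtain ⟨⟨b, ⟨_, k, rfl⟩⟩, hb⟩ := IsLocalization.surj (.powers f) a
  refine ⟨k, fun l hl => ⟨f ^ (l - k) * b, ?_⟩⟩
  have hb' : a * res (X.basicOpen_le f) (f ^ k) = res (X.basicOpen_le f) b := hb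
  rw [map_mul, ← hb', map_pow, map_pow, mul_comm a, ← mul_assoc, ← pow_add, Nat.sub_add_cancel hl]

variable {M} in
lemma exists_pow_smul_eq_sum [hM : SheafOfModules.IsQuasicoherent (R := X.ringCatSheaf) M]
    (hV : IsAffineOpen V) (f : Γ(X, V)) (s : ι → Γ(M, V)) (t : Γ(M, V))
    (a : ι → Γ(X, X.basicOpen f))
    (h : modRes M (X.basicOpen_le f) t = ∑ i, a i • modRes M (X.basicOpen_le f) (s i)) :
    ∃ (k : ℕ) (b : ι → Γ(X, V)), f ^ k • t = ∑ i, b i • s i := by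
  choose k hk using fun i => exists_res_eq_pow_mul hV f (a i)
  choose b hb using fun i => hk i (Finset.univ.sup k) (Finset.le_sup (Finset.mem_univ i))
  obtain ⟨l, hl⟩ := exists_pow_smul_eq_zero M hV f
    (f ^ (Finset.univ.sup k) • t - ∑ i, b i • s i) (by
      rw [map_sub, map_sum, modRes_smul, h, map_pow, Finset.smul_sum, sub_eq_zero]
      refine Finset.sum_congr rfl fun i _ => ?_
      rw [modRes_smul, hb, mul_smul])
  refine ⟨l + Finset.univ.sup k, fun i => f ^ l * b i, ?_⟩
  rw [smul_sub, sub_eq_zero, ← mul_smul, ← pow_add, Finset.smul_sum] at hl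
  rw [hl]
  exact Finset.sum_congr rfl fun i _ => (mul_smul _ _ _).symm

/-- Sections which generate a quasi-coherent sheaf on an affine open set generate its module of
sections. -/
lemma LocallySpan.exists_eq_sum [hM : SheafOfModules.IsQuasicoherent (R := X.ringCatSheaf) M]
    (hV : IsAffineOpen V) {s : ι → Γ(M, V)} (hs : LocallySpan s V) (t : Γ(M, V)) :
    ∃ b : ι → Γ(X, V), t = ∑ i, b i • s i := by
  -- the ideal of all functions which multiply `t` into the span; it lies in no prime ideal
  let I : Ideal Γ(X, V) := (Submodule.span Γ(X, V) (Set.range s)).comap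
    (LinearMap.toSpanSingleton Γ(X, V) _ t)
  have hI : ∀ x ∈ V, ∃ f ∈ I.radical, x ∈ X.basicOpen f := by
    intro x hx
    obtain ⟨W, hWV, hWV', a, hxW, ha⟩ := hs V le_rfl t x hx
    obtain ⟨f, hfW, hxf⟩ := hV.exists_basicOpen_le ⟨x, hxW⟩ hx
    obtain ⟨k, b, hb⟩ := exists_pow_smul_eq_sum hV f s t (fun i => res hfW (a i)) (by
      have := congrArg (modRes M hfW) ha
      rw [modRes_modRes, map_sum] at this
      rw [this]
      refine Finset.sum_congr rfl fun i _ => ?_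
      rw [modRes_smul, modRes_modRes])
    refine ⟨f, ⟨k, ?_⟩, hxf⟩
    change f ^ k • t ∈ Submodule.span Γ(X, V) (Set.range s)
    rw [hb]
    exact Submodule.sum_mem _ fun i _ => Submodule.smul_mem _ _ (Submodule.subset_span ⟨i, rfl⟩)
  have htop : I.radical = ⊤ := by
    rw [← Ideal.span_eq I.radical, ← hV.self_le_iSup_basicOpen_iff]
    intro x hx
    obtain ⟨f, hf, hxf⟩ := hI x hx
    exact TopologicalSpace.Opens.mem_iSup.2 ⟨⟨f, hf⟩, hxf⟩
  have h1 : (1 : Γ(X, V)) ∈ I := by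
    rw [Ideal.radical_eq_top] at htop
    rw [htop]
    trivial
  have h2 : (1 : Γ(X, V)) • t ∈ Submodule.span Γ(X, V) (Set.range s) := h1
  rw [one_smul, Submodule.mem_span_range_iff_exists_fun] at h2
  obtain ⟨b, hb⟩ := h2
  exact ⟨b, hb.symm⟩

end AffineSections

/-! ### Generically generating sections and conductors -/

lemma isQuasicoherent_of_isFinitePresentation {X : Scheme.{u}} (M : X.Modules)
    [hM : SheafOfModules.IsFinitePresentation (R := X.ringCatSheaf) M] :
    SheafOfModules.IsQuasicoherent (R := X.ringCatSheaf) M := by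
  obtain ⟨σ, _⟩ := hM.exists_quasicoherentData
  constructor
  exact ⟨σ⟩

section GenericallySpanned

variable {C : Scheme.{u}} {H : C.Modules} {ι : Type*} (s : ι → Γ(H, ⊤))

/-- The submodule of `Γ(U, H)` generated by the restrictions of the global sections `s i`. -/
def spanSections (U : C.Opens) : Submodule Γ(C, U) Γ(H, U) :=
  Submodule.span Γ(C, U) (Set.range fun i => modRes H le_top (s i))

variable {s}

lemma mem_spanSections_of_isUnit_smul {U : C.Opens} {a : Γ(C, U)} (ha : IsUnit a) {t : Γ(H, U)}
    (h : a • t ∈ spanSections s U) : t ∈ spanSections s U := by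
  obtain ⟨b, hb⟩ := ha.exists_left_inv
  have := (spanSections s U).smul_mem b h
  rwa [← mul_smul, hb, one_smul] at this

variable [Fintype ι]

lemma mem_spanSections_iff {U : C.Opens} {t : Γ(H, U)} :
    t ∈ spanSections s U ↔ ∃ a : ι → Γ(C, U), ∑ i, a i • modRes H le_top (s i) = t :=
  Submodule.mem_span_range_iff_exists_fun _

lemma modRes_mem_spanSections {U V : C.Opens} (h : V ≤ U) {t : Γ(H, U)}
    (ht : t ∈ spanSections s U) : modRes H h t ∈ spanSections s V := by
  obtain ⟨a, rfl⟩ := mem_spanSections_iff.1 ht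
  refine mem_spanSections_iff.2 ⟨fun i => res h (a i), ?_⟩
  rw [map_sum]
  exact Finset.sum_congr rfl fun i _ => by rw [modRes_smul, modRes_modRes]

lemma LocallySpan.exists_mem_spanSections {U₀ : C.Opens} (hs : LocallySpan s U₀) {W : C.Opens}
    (hW : W ≤ U₀) (t : Γ(H, W)) {x : C} (hx : x ∈ W) :
    ∃ (V : C.Opens) (h : V ≤ W), x ∈ V ∧ modRes H h t ∈ spanSections s V := by
  obtain ⟨V, hVW, _, a, hxV, ha⟩ := hs W hW t x hx
  exact ⟨V, hVW, hxV, mem_spanSections_iff.2 ⟨a, ha.symm⟩⟩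

variable (s) in
/-- The sections `s i` are linearly independent over the functions on every open set. -/
def IsIndependent : Prop :=
  ∀ (U : C.Opens) (a : ι → Γ(C, U)), ∑ i, a i • modRes H (le_top : U ≤ ⊤) (s i) = 0 → a = 0

lemma IsIndependent.injective (hs : IsIndependent s) {U : C.Opens} {a b : ι → Γ(C, U)}
    (h : ∑ i, a i • modRes H (le_top : U ≤ ⊤) (s i) =
      ∑ i, b i • modRes H (le_top : U ≤ ⊤) (s i)) : a = b := by
  rw [← sub_eq_zero]
  apply hs
  simp [sub_smul, h]

/-- For linearly independent sections, being in their span is a local property: the coefficients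
are unique and therefore glue. -/
lemma IsIndependent.mem_spanSections_of_locally (hs : IsIndependent s) {U : C.Opens} {t : Γ(H, U)}
    (h : ∀ x ∈ U, ∃ (V : C.Opens) (hV : V ≤ U), x ∈ V ∧ modRes H hV t ∈ spanSections s V) :
    t ∈ spanSections s U := by
  choose V hV hxV ht using h
  choose a ha using fun x hx => mem_spanSections_iff.1 (ht x hx)
  let W : U → C.Opens := fun x => V x.1 x.2
  have hUW : U ≤ iSup W := fun x hx => TopologicalSpace.Opens.mem_iSup.2 ⟨⟨x, hx⟩, hxV x hx⟩
  have hg : ∀ i, ∃ b : Γ(C, U), ∀ x : U, res (hV x.1 x.2) b = a x.1 x.2 i := by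
    intro i
    obtain ⟨b, hb, -⟩ := exists_unique_glue W U hUW
      (fun x => res inf_le_right (a x.1 x.2 i)) (by
        intro x y
        rw [res_res, res_res]
        have hxy : (fun i => res (inf_le_right.trans inf_le_left : U ⊓ (W x ⊓ W y) ≤ W x)
            (a x.1 x.2 i)) =
            fun i => res (inf_le_right.trans inf_le_right : U ⊓ (W x ⊓ W y) ≤ W y)
            (a y.1 y.2 i) := by
          apply hs.injective
          have h1 := congrArg (modRes H (inf_le_right.trans inf_le_left :
            U ⊓ (W x ⊓ W y) ≤ W x)) (ha x.1 x.2)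
          have h2 := congrArg (modRes H (inf_le_right.trans inf_le_right :
            U ⊓ (W x ⊓ W y) ≤ W y)) (ha y.1 y.2)
          simp only [map_sum, modRes_smul, modRes_modRes] at h1 h2
          rw [h1, h2]
        exact congrFun hxy i)
    refine ⟨b, fun x => ?_⟩
    have hle : W x ≤ U ⊓ W x := le_inf (hV x.1 x.2) le_rfl
    have := congrArg (res hle) (hb x)
    rw [res_res, res_res, res_self] at this
    exact this
  choose b hb using hg
  refine mem_spanSections_iff.2 ⟨b, modRes_ext fun x hx => ⟨V x hx, hV x hx, hxV x hx, ?_⟩⟩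
  rw [← ha x hx, map_sum]
  refine Finset.sum_congr rfl fun i _ => ?_
  rw [modRes_smul, modRes_modRes, hb i ⟨x, hx⟩]

variable [IsIntegral C] [hH : SheafOfModules.IsFinitePresentation (R := C.ringCatSheaf) H]
  {U₀ : C.Opens}

/-- If the global sections `s i` generate `H` on a nonempty open set, every section over an affine
open set has a nonzero multiple in their span. -/
lemma LocallySpan.exists_smul_mem_spanSections (hs : LocallySpan s U₀) (hU₀ : (U₀ : Set C).Nonempty)
    {V : C.Opens} (hV : IsAffineOpen V) (hVne : (V : Set C).Nonempty) (t : Γ(H, V)) :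
    ∃ a : Γ(C, V), a ≠ 0 ∧ a • t ∈ spanSections s V := by
  have := isQuasicoherent_of_isFinitePresentation H
  obtain ⟨x, hxV, hx₀⟩ := nonempty_preirreducible_inter V.isOpen U₀.isOpen hVne hU₀
  obtain ⟨W, hW, hxW, ht⟩ := hs.exists_mem_spanSections (inf_le_right : V ⊓ U₀ ≤ U₀)
    (modRes H inf_le_left t) ⟨hxV, hx₀⟩
  obtain ⟨f, hfW, hxf⟩ := hV.exists_basicOpen_le ⟨x, hxW⟩ hxV
  have h2 := modRes_mem_spanSections hfW ht
  rw [modRes_modRes, modRes_modRes] at h2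
  obtain ⟨a, ha⟩ := mem_spanSections_iff.1 h2
  obtain ⟨k, b, hb⟩ := exists_pow_smul_eq_sum hV f (fun i => modRes H le_top (s i)) t a (by
    rw [← ha]
    exact Finset.sum_congr rfl fun i _ => by rw [modRes_modRes])
  have : Nonempty V := ⟨⟨x, hxV⟩⟩
  refine ⟨f ^ k, pow_ne_zero k ?_, mem_spanSections_iff.2 ⟨b, hb.symm⟩⟩
  rintro rfl
  simp at hxf

/-- A conductor: on an affine open set `V`, a single nonzero function multiplies all sections of `H`
over open subsets of `V` into the span of generically generating sections. -/
lemma LocallySpan.exists_conductor (hs : LocallySpan s U₀) (hU₀ : (U₀ : Set C).Nonempty)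
    (hind : IsIndependent s) {V : C.Opens} (hV : IsAffineOpen V) (hVne : (V : Set C).Nonempty) :
    ∃ a : Γ(C, V), a ≠ 0 ∧ ∀ (W : C.Opens) (hW : W ≤ V) (t : Γ(H, W)),
      res hW a • t ∈ spanSections s W := by
  have hVne' : Nonempty V := hVne.to_subtype
  have key : ∀ x : V, ∃ f b : Γ(C, V), x.1 ∈ C.basicOpen f ∧ b ≠ 0 ∧
      ∀ (W : C.Opens) (hW : W ≤ V) (_ : W ≤ C.basicOpen f) (t : Γ(H, W)),
        res hW b • t ∈ spanSections s W := by
    rintro ⟨x, hxV⟩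
    obtain ⟨U, hxU, n, g, hg⟩ := exists_locallySpan_of_isFinitePresentation H x
    obtain ⟨f, hfU, hxf⟩ := hV.exists_basicOpen_le ⟨x, hxU⟩ hxV
    have hfne : ((C.basicOpen f : C.Opens) : Set C).Nonempty := ⟨x, hxf⟩
    have : Nonempty (C.basicOpen f) := hfne.to_subtype
    choose c hc0 hc using fun j =>
      hs.exists_smul_mem_spanSections hU₀ (hV.basicOpen f) hfne (modRes H hfU (g j))
    obtain ⟨k, hk⟩ := exists_res_eq_pow_mul hV f (∏ j, c j)
    obtain ⟨b, hb⟩ := hk k le_rfl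
    refine ⟨f, b, hxf, ?_, fun W hW hWf t => ?_⟩
    · rintro rfl
      rw [map_zero] at hb
      refine mul_ne_zero ?_ (Finset.prod_ne_zero_iff.2 fun j _ => hc0 j) hb.symm
      exact ((res_basicOpen_isUnit f).pow k).ne_zero
    · refine hind.mem_spanSections_of_locally fun y hy => ?_
      obtain ⟨W', hW', hW'U, e, hyW', he⟩ := hg W (hWf.trans hfU) t y hy
      refine ⟨W', hW', hyW', ?_⟩
      rw [modRes_smul, he, res_res, Finset.smul_sum]
      refine Submodule.sum_mem _ fun j _ => ?_
      rw [smul_comm]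
      refine Submodule.smul_mem _ _ ?_
      have hres : res (hW'.trans hW) b = res (hW'.trans hWf) (res (C.basicOpen_le f) b) :=
        (res_res _ _ _).symm
      obtain ⟨d, hd⟩ := Finset.dvd_prod_of_mem c (Finset.mem_univ j)
      have h1 := modRes_mem_spanSections (hW'.trans hWf) (hc j)
      rw [modRes_smul, modRes_modRes] at h1
      rw [hres, hb, hd, mul_comm (c j), ← mul_assoc, map_mul, mul_smul]
      exact Submodule.smul_mem _ _ h1
  choose f b hxf hb0 hb using key
  obtain ⟨T, hT⟩ := hV.isCompact.elim_finite_subcover (fun x : V => (C.basicOpen (f x) : Set C))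
    (fun x => (C.basicOpen (f x)).isOpen) (fun x hx => Set.mem_iUnion.2 ⟨⟨x, hx⟩, hxf ⟨x, hx⟩⟩)
  refine ⟨∏ x ∈ T, b x, Finset.prod_ne_zero_iff.2 fun x _ => hb0 x, fun W hW t => ?_⟩
  refine hind.mem_spanSections_of_locally fun y hy => ?_
  obtain ⟨x, hx⟩ := Set.mem_iUnion.1 (hT (hW hy))
  obtain ⟨hxT, hyx⟩ := Set.mem_iUnion.1 hx
  refine ⟨W ⊓ C.basicOpen (f x), inf_le_left, ⟨hy, hyx⟩, ?_⟩
  obtain ⟨d, hd⟩ := Finset.dvd_prod_of_mem b hxT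
  rw [modRes_smul, res_res, hd, mul_comm, map_mul, mul_smul]
  exact Submodule.smul_mem _ _ (hb x _ _ inf_le_right _)

end GenericallySpanned

/-! ### Approximation of sections on curves -/

section CurveSections

variable {k : Type u} [Field k]

/-- The quotients of the coordinate rings of affine open subschemes by nonzero elements are
finite-dimensional over `k`. This is the property of integral curves of finite type over `k` that
is used below. -/
def HasFiniteQuotients {C : Scheme.{u}} (f : C ⟶ Spec (.of k)) : Prop :=
  ∀ (V : C.Opens), IsAffineOpen V → ∀ a : Γ(C, V), a ≠ 0 →
    ((Ideal.Quotient.mk (Ideal.span {a})).comp (scalar f V)).Finite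

lemma HasFiniteQuotients.isArtinianRing {C : Scheme.{u}} {f : C ⟶ Spec (.of k)}
    (hC : HasFiniteQuotients f) {V : C.Opens} (hV : IsAffineOpen V) {a : Γ(C, V)} (ha : a ≠ 0) :
    IsArtinianRing (Γ(C, V) ⧸ Ideal.span {a}) := by
  algebraize [(Ideal.Quotient.mk (Ideal.span {a})).comp (scalar f V)]
  have : Module.Finite k (Γ(C, V) ⧸ Ideal.span {a}) := hC V hV a ha
  exact IsArtinianRing.of_finite k _

lemma fromSpec_mem_basicOpen_iff {X : Scheme.{u}} {V : X.Opens} (hV : IsAffineOpen V)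
    (p : PrimeSpectrum Γ(X, V)) (g : Γ(X, V)) :
    hV.fromSpec p ∈ X.basicOpen g ↔ g ∉ p.asIdeal := by
  have := hV.fromSpec_preimage_basicOpen g
  change p ∈ hV.fromSpec ⁻¹ᵁ X.basicOpen g ↔ _
  rw [this]
  rfl

variable {C : Scheme.{u}} [IsIntegral C] {f : C ⟶ Spec (.of k)} {H : C.Modules}
  [hH : SheafOfModules.IsFinitePresentation (R := C.ringCatSheaf) H] {ι : Type*} [Fintype ι]
  {s : ι → Γ(H, ⊤)} {U₀ : C.Opens}

/-- Sections of `H` prescribed near each point of an affine open set `V` can be approximated, up to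
the span of generically generating sections, by one section over `V`: the cokernel of
`𝒪ʳ → H` is a skyscraper sheaf. -/
lemma LocallySpan.exists_approximation (hC : HasFiniteQuotients f) (hs : LocallySpan s U₀)
    (hU₀ : (U₀ : Set C).Nonempty) (hind : IsIndependent s) {V : C.Opens} (hV : IsAffineOpen V)
    (U : C → C.Opens) (hU : ∀ x ∈ V, x ∈ U x) (t : ∀ x, Γ(H, U x)) :
    ∃ n : Γ(H, V), ∀ x ∈ V, ∃ (W : C.Opens) (hWV : W ≤ V) (hWU : W ≤ U x),
      x ∈ W ∧ modRes H hWV n - modRes H hWU (t x) ∈ spanSections s W := by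
  classical
  have := isQuasicoherent_of_isFinitePresentation H
  by_cases hVne : (V : Set C).Nonempty
  swap
  · exact ⟨0, fun x hx => (hVne ⟨x, hx⟩).elim⟩
  obtain ⟨a, ha0, ha⟩ := hs.exists_conductor hU₀ hind hV hVne
  let I := Ideal.span {a}
  have hI : ∀ b ∈ I, ∀ (W : C.Opens) (hW : W ≤ V) (t : Γ(H, W)),
      res hW b • t ∈ spanSections s W := by
    intro b hb W hW t
    obtain ⟨c, rfl⟩ := Ideal.mem_span_singleton'.1 hb
    rw [map_mul, mul_smul]
    exact Submodule.smul_mem _ _ (ha W hW t)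
  have hart : IsArtinianRing (Γ(C, V) ⧸ I) := hC.isArtinianRing hV ha0
  let y : PrimeSpectrum Γ(C, V) → C := fun p => hV.fromSpec p
  have hyV : ∀ p, y p ∈ V := fun p => hV.range_fromSpec.le ⟨p, rfl⟩
  -- write the given section near `y p` as a fraction `n p / h p`
  have hfrac : ∀ p, ∃ (g h : Γ(C, V)) (n : Γ(H, V)) (hgU : C.basicOpen g ≤ U (y p)),
      g ∉ p.asIdeal ∧ h ∉ p.asIdeal ∧ modRes H (C.basicOpen_le g) n =
        res (C.basicOpen_le g) h • modRes H hgU (t (y p)) := by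
    intro p
    obtain ⟨g, hgU, hg⟩ := hV.exists_basicOpen_le ⟨y p, hU _ (hyV p)⟩ (hyV p)
    obtain ⟨l, n, hn⟩ := exists_modRes_eq_pow_smul H hV g (modRes H hgU (t (y p)))
    have hgp : g ∉ p.asIdeal := (fromSpec_mem_basicOpen_iff hV p g).1 hg
    exact ⟨g, g ^ l, n, hgU, hgp, fun h => hgp (p.2.mem_of_pow_mem l h), by rw [hn, map_pow]⟩
  choose g h n hgU hgp hhp hn using hfrac
  obtain ⟨c, hc⟩ := exists_local_inverses I h hhp
  let _ := Fintype.ofFinite (PrimeSpectrum (Γ(C, V) ⧸ I))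
  let π := Ideal.Quotient.mk I
  refine ⟨∑ P, c P • n (PrimeSpectrum.comap π P), fun x hx => ?_⟩
  by_cases hxa : x ∈ C.basicOpen a
  · have hle : U x ⊓ C.basicOpen a ≤ V := inf_le_right.trans (C.basicOpen_le a)
    exact ⟨U x ⊓ C.basicOpen a, hle, inf_le_left, ⟨hU x hx, hxa⟩,
      mem_spanSections_of_isUnit_smul (isUnit_res_of_le hle a inf_le_right) (ha _ hle _)⟩
  · obtain ⟨p, rfl⟩ : ∃ p, y p = x := hV.range_fromSpec.ge hx
    have hap : a ∈ p.asIdeal := by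
      by_contra hap
      exact hxa ((fromSpec_mem_basicOpen_iff hV p a).2 hap)
    obtain ⟨P, rfl⟩ : ∃ P, PrimeSpectrum.comap π P = p := by
      have : p ∈ Set.range (PrimeSpectrum.comap π) := by
        rw [range_comap_of_surjective _ π Ideal.Quotient.mk_surjective,
          Ideal.mk_ker, PrimeSpectrum.mem_zeroLocus]
        exact (Ideal.span_singleton_le_iff_mem _).2 hap
      exact this
    set p := PrimeSpectrum.comap π P
    obtain ⟨v, hvp, hv1, hv2⟩ := hc P
    let W := C.basicOpen (g p) ⊓ C.basicOpen (h p) ⊓ C.basicOpen v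
    have hWV : W ≤ V := inf_le_right.trans (C.basicOpen_le v)
    have hWg : W ≤ C.basicOpen (g p) := inf_le_left.trans inf_le_left
    refine ⟨W, hWV, hWg.trans (hgU p), ⟨⟨(fromSpec_mem_basicOpen_iff hV p _).2 (hgp p),
      (fromSpec_mem_basicOpen_iff hV p _).2 (hhp p)⟩,
      (fromSpec_mem_basicOpen_iff hV p _).2 hvp⟩, ?_⟩
    have hunit : IsUnit (res hWV (v * h p)) := by
      rw [map_mul]
      exact (isUnit_res_of_le hWV v inf_le_right).mul
        (isUnit_res_of_le hWV (h p) (inf_le_left.trans inf_le_right))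
    refine mem_spanSections_of_isUnit_smul hunit ?_
    have hnp := congrArg (modRes H hWg) (hn p)
    rw [modRes_smul, modRes_modRes, modRes_modRes, res_res] at hnp
    have hsplit : res hWV (v * h p) • (modRes H hWV (∑ Q, c Q • n (PrimeSpectrum.comap π Q)) -
        modRes H (hWg.trans (hgU p)) (t (y p))) =
        res hWV (v * (h p * c P - 1)) • modRes H hWV (n p) +
        ∑ Q ∈ Finset.univ.erase P, res hWV (v * c Q) •
          (res hWV (h p) • modRes H hWV (n (PrimeSpectrum.comap π Q))) := by
      rw [smul_sub, map_mul, mul_smul _ _ (modRes H (hWg.trans (hgU p)) (t (y p))), ← hnp,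
        map_sum, ← Finset.add_sum_erase _ _ (Finset.mem_univ P), smul_add, Finset.smul_sum]
      simp only [modRes_smul, map_mul, map_sub, map_one, smul_smul]
      rw [add_sub_right_comm, ← sub_smul]
      congr 1
      · congr 1
        ring
      · refine Finset.sum_congr rfl fun Q _ => ?_
        congr 1
        ring
    rw [hsplit]
    refine Submodule.add_mem _ (hI _ hv1 W hWV _) (Submodule.sum_mem _ fun Q hQ => ?_)
    exact hI _ (hv2 Q (Finset.ne_of_mem_erase hQ)) W hWV _

variable (f s) in
/-- The span of the sections `s i` in the `k`-vector space of sections of `H` over `U`. -/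
def secSpan (U : C.Opens) : Submodule k (Sec f H U) where
  carrier := {t | (show Γ(H, U) from t) ∈ spanSections s U}
  add_mem' := fun ha hb => (spanSections s U).add_mem ha hb
  zero_mem' := (spanSections s U).zero_mem
  smul_mem' := fun c _ ht => (spanSections s U).smul_mem (scalar f U c) ht

/-- On an affine open set over which `H` is generated by finitely many sections, the span of
generically generating sections has finite codimension. -/
lemma finite_quotient_secSpan (hC : HasFiniteQuotients f) (hs : LocallySpan s U₀)
    (hU₀ : (U₀ : Set C).Nonempty) (hind : IsIndependent s) {V : C.Opens} (hV : IsAffineOpen V)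
    (hVne : (V : Set C).Nonempty) {m : ℕ} {g : Fin m → Γ(H, V)} (hg : LocallySpan g V) :
    Module.Finite k (Sec f H V ⧸ secSpan f s V) := by
  classical
  have := isQuasicoherent_of_isFinitePresentation H
  obtain ⟨a, ha0, ha⟩ := hs.exists_conductor hU₀ hind hV hVne
  obtain ⟨N, e, he⟩ : ∃ (N : ℕ) (e : Fin N → Γ(C, V)), ∀ b : Γ(C, V), ∃ c : Fin N → k,
      b - ∑ i, scalar f V (c i) * e i ∈ Ideal.span {a} := by
    algebraize [(Ideal.Quotient.mk (Ideal.span {a})).comp (scalar f V)]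
    have : Module.Finite k (Γ(C, V) ⧸ Ideal.span {a}) := hC V hV a ha0
    obtain ⟨N, e, he⟩ := Module.Finite.exists_fin (R := k) (M := Γ(C, V) ⧸ Ideal.span {a})
    choose e' he' using fun i => Ideal.Quotient.mk_surjective (e i)
    refine ⟨N, e', fun b => ?_⟩
    have hb : Ideal.Quotient.mk (Ideal.span {a}) b ∈ Submodule.span k (Set.range e) :=
      he ▸ Submodule.mem_top
    obtain ⟨c, hc⟩ := (Submodule.mem_span_range_iff_exists_fun k).1 hb
    refine ⟨c, ?_⟩
    rw [← Ideal.Quotient.eq_zero_iff_mem, map_sub, sub_eq_zero, ← hc, map_sum]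
    refine Finset.sum_congr rfl fun i _ => ?_
    rw [map_mul, he']
    exact Algebra.smul_def _ _
  refine ⟨⟨Finset.univ.image (fun ij : Fin N × Fin m =>
    Submodule.Quotient.mk (p := secSpan f s V) (show Sec f H V from e ij.1 • g ij.2)), ?_⟩⟩
  rw [eq_top_iff]
  rintro q -
  obtain ⟨t, rfl⟩ := Submodule.Quotient.mk_surjective _ q
  obtain ⟨b, hb⟩ := LocallySpan.exists_eq_sum H hV hg (show Γ(H, V) from t)
  choose c hc using fun j => he (b j)
  let t' : Sec f H V := ∑ j, ∑ i, c j i • (show Sec f H V from e i • g j)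
  have htt' : Submodule.Quotient.mk (p := secSpan f s V) t = Submodule.Quotient.mk t' := by
    rw [Submodule.Quotient.eq]
    have h1 : (show Γ(H, V) from t - t') =
        ∑ j, (b j - ∑ i, scalar f V (c j i) * e i) • g j := by
      change (show Γ(H, V) from t) - ∑ j, ∑ i, scalar f V (c j i) • (e i • g j) = _
      rw [hb, ← Finset.sum_sub_distrib]
      refine Finset.sum_congr rfl fun j _ => ?_
      rw [sub_smul, Finset.sum_smul]
      simp only [mul_smul]
    change (show Γ(H, V) from t - t') ∈ spanSections s V
    rw [h1]
    refine Submodule.sum_mem _ fun j _ => ?_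
    obtain ⟨d, hd⟩ := Ideal.mem_span_singleton'.1 (hc j)
    rw [← hd, mul_smul]
    have := ha V le_rfl (g j)
    rw [res_self] at this
    exact Submodule.smul_mem _ _ this
  rw [htt']
  change Submodule.mkQ _ t' ∈ _
  rw [map_sum]
  refine Submodule.sum_mem _ fun j _ => ?_
  rw [map_sum]
  refine Submodule.sum_mem _ fun i _ => ?_
  rw [map_smul]
  refine Submodule.smul_mem _ _ (Submodule.subset_span ?_)
  simp only [Finset.coe_image, Finset.coe_univ, Set.image_univ, Set.mem_range]
  exact ⟨(i, j), rfl⟩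

end CurveSections

/-! ### Dimension counts and maps on Čech cohomology -/

section LinearAlgebra

variable {k : Type*} [Field k] {ι : Type*} {V W : Type*} [AddCommGroup V] [Module k V]
  [AddCommGroup W] [Module k W]

lemma finite_of_finite_fun [Nonempty ι] [Module.Finite k (ι → V)] : Module.Finite k V :=
  Module.Finite.of_surjective 
    (LinearMap.proj (R := k) (φ := fun _ : ι => V) (Classical.arbitrary ι))
    (LinearMap.proj_surjective _)

variable [Fintype ι]

/-- The inequality of dimensions for an injection with finite-dimensional cokernel. It also holds
for the junk value `0` of `finrank` at infinite-dimensional spaces. -/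
lemma card_mul_finrank_le (α : (ι → V) →ₗ[k] W) (hα : Function.Injective α)
    (hfin : Module.Finite k (W ⧸ LinearMap.range α)) :
    Fintype.card ι * Module.finrank k V ≤ Module.finrank k W := by
  by_cases hV : Module.Finite k V
  · have h1 : Module.finrank k (ι → V) = Fintype.card ι * Module.finrank k V := by
      simp [Module.finrank_pi_fintype]
    have : Module.Finite k (LinearMap.range α) := inferInstance
    have : Module.Finite k W := Module.Finite.of_submodule_quotient (LinearMap.range α)
    exact h1 ▸ LinearMap.finrank_le_finrank_of_injective hα
  · rw [Module.finrank_of_not_finite hV, mul_zero]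
    exact Nat.zero_le _

/-- The inequality of dimensions for a surjection with finite-dimensional kernel. It also holds
for the junk value `0` of `finrank` at infinite-dimensional spaces. -/
lemma finrank_le_card_mul (β : (ι → V) →ₗ[k] W) (hβ : Function.Surjective β)
    (hfin : Module.Finite k (LinearMap.ker β)) :
    Module.finrank k W ≤ Fintype.card ι * Module.finrank k V := by
  by_cases hW : Module.Finite k W
  · have : Module.Finite k (ι → V) := by
      have : Module.Finite k ((ι → V) ⧸ LinearMap.ker β) :=
        Module.Finite.equiv (β.quotKerEquivOfSurjective hβ).symm
      exact Module.Finite.of_submodule_quotient (LinearMap.ker β)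
    have h1 := LinearMap.finrank_le_finrank_of_surjective hβ
    rcases isEmpty_or_nonempty ι with h | h
    · rw [Module.finrank_zero_of_subsingleton (M := ι → V)] at h1
      exact h1.trans (Nat.zero_le _)
    · have : Module.Finite k V := finite_of_finite_fun (ι := ι)
      simpa [Module.finrank_pi_fintype] using h1
  · rw [Module.finrank_of_not_finite hW]
    exact Nat.zero_le _

/-- If the elements of `L` lift along `p` to the kernel of `Ψ`, on which `ker ρ` is contained in
`ker p`, then the dimension of `L` is at most that of the target of `ρ`. -/
lemma finite_of_lift_of_ker_le {B F : Type*} [AddCommGroup B] [Module k B] [AddCommGroup F]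
    [Module k F] [Module.Finite k F] (Ψ : V →ₗ[k] B) (ρ : V →ₗ[k] F) (p : V →ₗ[k] W)
    (h : ∀ x, Ψ x = 0 → ρ x = 0 → p x = 0) (L : Submodule k W)
    (hL : ∀ w ∈ L, ∃ x, Ψ x = 0 ∧ p x = w) : Module.Finite k L := by
  let ρ' := ρ ∘ₗ (LinearMap.ker Ψ).subtype
  let p' := p ∘ₗ (LinearMap.ker Ψ).subtype
  have h0 : LinearMap.ker ρ' ≤ LinearMap.ker p' := fun x hx => h x.1 x.2 hx
  have h1 : Module.Finite k (LinearMap.ker Ψ ⧸ LinearMap.ker ρ') :=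
    Module.Finite.equiv ρ'.quotKerEquivRange.symm
  have h2 : Module.Finite k (LinearMap.ker Ψ ⧸ LinearMap.ker p') :=
    Module.Finite.of_surjective (Submodule.factor h0) (Submodule.factor_surjective h0)
  have h3 : Module.Finite k (LinearMap.range p') := Module.Finite.equiv p'.quotKerEquivRange
  have hle : L ≤ LinearMap.range p' := by
    intro w hw
    obtain ⟨x, hx, rfl⟩ := hL w hw
    exact ⟨⟨x, hx⟩, rfl⟩
  exact Module.Finite.of_injective (Submodule.inclusion hle) (Submodule.inclusion_injective hle)

end LinearAlgebra

section Cech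

variable {k : Type u} [Field k] {C : Scheme.{u}} (f : C ⟶ Spec (.of k)) {H : C.Modules}

/-- Multiplication of functions with a global section of `H`. -/
def mulSec (s : Γ(H, ⊤)) (U : C.Opens) : Sec f (structureModule C) U →ₗ[k] Sec f H U where
  toFun a := (show Γ(C, U) from a) • modRes H le_top s
  map_add' a b := add_smul (show Γ(C, U) from a) (show Γ(C, U) from b) (modRes H le_top s : Γ(H, U))
  map_smul' c a := mul_smul (scalar f U c) (show Γ(C, U) from a) (modRes H le_top s : Γ(H, U))

variable {f} in
lemma secRes_mulSec (s : Γ(H, ⊤)) {U V : C.Opens} (h : V ≤ U) (a : Sec f (structureModule C) U) :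
    secRes f H h (mulSec f s U a) = mulSec f s V (secRes f _ h a) := by
  refine (modRes_smul h (show Γ(C, U) from a) (modRes H le_top s)).trans ?_
  rw [modRes_modRes]
  rfl

/-- The map on Čech `1`-cochains given by multiplication with a global section of `H`. -/
def mulCochain (s : Γ(H, ⊤)) :
    (∀ p : C.affineOpens × C.affineOpens, Sec f (structureModule C) (p.1 ⊓ p.2)) →ₗ[k]
      (∀ p : C.affineOpens × C.affineOpens, Sec f H (p.1 ⊓ p.2)) :=
  LinearMap.pi fun p => mulSec f s _ ∘ₗ LinearMap.proj p

lemma cechD1_mulCochain (s : Γ(H, ⊤))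
    (a : ∀ p : C.affineOpens × C.affineOpens, Sec f (structureModule C) (p.1 ⊓ p.2))
    (t : C.affineOpens × C.affineOpens × C.affineOpens) :
    cechD1 f H (mulCochain f s a) t = mulSec f s _ (cechD1 f _ a t) := by
  simp only [cechD1, LinearMap.pi_apply, LinearMap.add_apply, LinearMap.sub_apply,
    LinearMap.comp_apply, LinearMap.proj_apply, map_add, map_sub, ← secRes_mulSec]
  rfl

lemma cechD0_mulSec (s : Γ(H, ⊤))
    (b : ∀ U : C.affineOpens, Sec f (structureModule C) U) :
    cechD0 f H (fun U => mulSec f s U (b U)) = mulCochain f s (cechD0 f _ b) := by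
  funext p
  simp only [cechD0, mulCochain, LinearMap.pi_apply, LinearMap.sub_apply,
    LinearMap.comp_apply, LinearMap.proj_apply, map_sub, ← secRes_mulSec]

/-- The map on Čech `1`-cocycles given by multiplication with a global section of `H`. -/
def mulCocycle (s : Γ(H, ⊤)) :
    LinearMap.ker (cechD1 f (structureModule C)) →ₗ[k] LinearMap.ker (cechD1 f H) :=
  (mulCochain f s).restrict fun a ha => by
    rw [LinearMap.mem_ker] at ha ⊢
    funext t
    rw [cechD1_mulCochain, ha]
    exact map_zero (mulSec f s _)

/-- The map on first Čech cohomology given by multiplication with a global section of `H`. -/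
def mulCechH1 (s : Γ(H, ⊤)) : CechH1 f (structureModule C) →ₗ[k] CechH1 f H :=
  Submodule.mapQ _ _ (mulCocycle f s) (by
    rintro ⟨a, ha⟩ ⟨b, hb⟩
    refine ⟨fun U => mulSec f s U (b U), ?_⟩
    rw [cechD0_mulSec, hb]
    rfl)

variable {ι : Type*} [Fintype ι] (s : ι → Γ(H, ⊤))

/-- The map `𝒪^ι → H` given by global sections `s i`, on sections over `U`. -/
def sumSec (U : C.Opens) : (ι → Sec f (structureModule C) U) →ₗ[k] Sec f H U :=
  ∑ i, mulSec f (s i) U ∘ₗ LinearMap.proj i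

/-- The map `H¹(𝒪)^ι → H¹(H)` given by global sections `s i`. -/
def sumCechH1 : (ι → CechH1 f (structureModule C)) →ₗ[k] CechH1 f H :=
  ∑ i, mulCechH1 f (s i) ∘ₗ LinearMap.proj i

lemma sumSec_apply (U : C.Opens) (a : ι → Sec f (structureModule C) U) :
    sumSec f s U a = ∑ i, mulSec f (s i) U (a i) := by
  simp [sumSec]

/-- `sumSec` in terms of the module structure over functions. -/
lemma sumSec_eq (U : C.Opens) (a : ι → Sec f (structureModule C) U) :
    sumSec f s U a = (∑ i, (show Γ(C, U) from a i) • modRes H le_top (s i) : Γ(H, U)) :=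
  sumSec_apply f s U a

lemma secRes_sumSec {U V : C.Opens} (h : V ≤ U) (a : ι → Sec f (structureModule C) U) :
    secRes f H h (sumSec f s U a) = sumSec f s V (fun i => secRes f _ h (a i)) := by
  simp only [sumSec_apply, map_sum, secRes_mulSec]

lemma mem_range_sumSec_iff {U : C.Opens} {t : Sec f H U} :
    t ∈ secSpan f s U ↔ ∃ a, sumSec f s U a = t := by
  refine mem_spanSections_iff.trans ?_
  exact ⟨fun ⟨a, ha⟩ => ⟨a, (sumSec_eq f s U a).trans ha⟩,
    fun ⟨a, ha⟩ => ⟨a, (sumSec_eq f s U a).symm.trans ha⟩⟩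

variable {s}

lemma IsIndependent.sumSec_injective (hs : IsIndependent s) (U : C.Opens) :
    Function.Injective (sumSec f s U) := by
  intro a b hab
  rw [sumSec_eq, sumSec_eq] at hab
  exact hs.injective (a := fun i => (show Γ(C, U) from a i))
    (b := fun i => (show Γ(C, U) from b i)) hab

variable {f}

lemma secRes_mem_secSpan {U V : C.Opens} (h : V ≤ U) {t : Sec f H U} (ht : t ∈ secSpan f s U) :
    secRes f H h t ∈ secSpan f s V :=
  modRes_mem_spanSections h ht

lemma IsIndependent.mem_secSpan_of_locally (hs : IsIndependent s) {U : C.Opens} {t : Sec f H U}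
    (h : ∀ x ∈ U, ∃ (V : C.Opens) (hV : V ≤ U), x ∈ V ∧ secRes f H hV t ∈ secSpan f s V) :
    t ∈ secSpan f s U :=
  hs.mem_spanSections_of_locally h

lemma secRes_secRes {U V W : C.Opens} (h : V ≤ U) (h' : W ≤ V) (s : Sec f H U) :
    secRes f H h' (secRes f H h s) = secRes f H (h'.trans h) s :=
  modRes_modRes h h' s

lemma sumCechH1_mk (a : ι → LinearMap.ker (cechD1 f (structureModule C))) :
    sumCechH1 f s (fun i => Submodule.Quotient.mk (a i)) =
      Submodule.Quotient.mk (∑ i, mulCocycle f (s i) (a i)) := by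
  rw [← Submodule.mkQ_apply, map_sum]
  simp [sumCechH1, mulCechH1]

lemma sum_mulCocycle_apply (a : ι → LinearMap.ker (cechD1 f (structureModule C)))
    (p : C.affineOpens × C.affineOpens) :
    (∑ i, mulCocycle f (s i) (a i)).1 p = sumSec f s _ (fun i => (a i).1 p) := by
  rw [sumSec_apply, Submodule.coe_sum, Finset.sum_apply]
  rfl

end Cech

/-! ### Nonnegativity of the degree -/

section Degree

variable {k : Type u} [Field k] {C : Scheme.{u}} {f : C ⟶ Spec (.of k)} {H : C.Modules}
  {ι : Type*} [Fintype ι] {s : ι → Γ(H, ⊤)} {U₀ : C.Opens}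

lemma LocallySpan.restrict {X : Scheme.{u}} {M : X.Modules} {U V : X.Opens} {s : ι → Γ(M, U)}
    (hs : LocallySpan s U) (h : V ≤ U) : LocallySpan (fun i => modRes M h (s i)) V := by
  intro W hW t x hx
  obtain ⟨W', hW', hWU, a, hxW', ha⟩ := hs W (hW.trans h) t x hx
  refine ⟨W', hW', hW'.trans hW, a, hxW', ha.trans ?_⟩
  exact Finset.sum_congr rfl fun i _ => by rw [modRes_modRes]

lemma cechD1_apply (g : ∀ p : C.affineOpens × C.affineOpens, Sec f H (p.1 ⊓ p.2))
    (U V W : C.affineOpens) :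
    cechD1 f H g (U, V, W) = secRes f H inf_le_right (g (V, W)) -
      secRes f H (le_inf inf_le_left (inf_le_right.trans inf_le_right)) (g (U, W)) +
      secRes f H (le_inf inf_le_left (inf_le_right.trans inf_le_left)) (g (U, V)) := rfl

lemma cechD0_apply (n : ∀ U : C.affineOpens, Sec f H U) (U V : C.affineOpens) :
    cechD0 f H n (U, V) = secRes f H inf_le_right (n V) - secRes f H inf_le_left (n U) := rfl

/-- The cocycle relation over any open subset of the triple intersection. -/
lemma cocycle_relation {g : ∀ p : C.affineOpens × C.affineOpens, Sec f H (p.1 ⊓ p.2)}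
    (hg : cechD1 f H g = 0) (U V W : C.affineOpens) {Y : C.Opens} (hU : Y ≤ U.1) (hV : Y ≤ V.1)
    (hW : Y ≤ W.1) :
    secRes f H (le_inf hV hW : Y ≤ V.1 ⊓ W.1) (g (V, W)) -
      secRes f H (le_inf hU hW : Y ≤ U.1 ⊓ W.1) (g (U, W)) +
      secRes f H (le_inf hU hV : Y ≤ U.1 ⊓ V.1) (g (U, V)) = 0 := by
  have h := congrArg (secRes f H (le_inf hU (le_inf hV hW) : Y ≤ U.1 ⊓ (V.1 ⊓ W.1)))
    (congrFun hg (U, V, W))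
  rw [cechD1_apply, map_add, map_sub, secRes_secRes, secRes_secRes, secRes_secRes] at h
  exact h.trans (map_zero (secRes f H _))

lemma exists_affine_mem (x : C) : ∃ U : C.affineOpens, x ∈ U.1 := by
  obtain ⟨U, hU, hx, -⟩ := exists_isAffineOpen_mem_and_subset (x := x) (U := ⊤) trivial
  exact ⟨⟨U, hU⟩, hx⟩

/-- If `∑ i, a i • s i` is the coboundary of a cochain of `H` which lies in the span of the `s i`
on a cover, then every `a i` is a coboundary. -/
lemma IsIndependent.exists_cechD0_eq (hind : IsIndependent s) {T : Set C.affineOpens}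
    (hT : ∀ x : C, ∃ V ∈ T, x ∈ V.1)
    (a : ι → ∀ p : C.affineOpens × C.affineOpens, Sec f (structureModule C) (p.1 ⊓ p.2))
    (n : ∀ U : C.affineOpens, Sec f H U)
    (ha : ∀ p, sumSec f s _ (fun i => a i p) = cechD0 f H n p)
    (hn : ∀ V ∈ T, n V ∈ secSpan f s V.1) (i : ι) :
    ∃ b, cechD0 f (structureModule C) b = a i := by
  have hn' : ∀ U : C.affineOpens, n U ∈ secSpan f s U.1 := by
    intro U
    refine hind.mem_secSpan_of_locally fun x hx => ?_
    obtain ⟨V, hVT, hxV⟩ := hT x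
    refine ⟨V.1 ⊓ U.1, inf_le_right, ⟨hxV, hx⟩, ?_⟩
    have h1 := ha (V, U)
    rw [cechD0_apply, eq_sub_iff_add_eq] at h1
    rw [← h1]
    exact Submodule.add_mem _ ((mem_range_sumSec_iff f s).2 ⟨_, rfl⟩)
      (secRes_mem_secSpan _ (hn V hVT))
  choose b hb using fun U : C.affineOpens => (mem_range_sumSec_iff f s).1 (hn' U)
  refine ⟨fun U => b U i, ?_⟩
  funext p
  suffices H : (fun i => cechD0 f (structureModule C) (fun U => b U i) p) =
      fun i => a i p from congrFun H i
  apply hind.sumSec_injective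
  obtain ⟨U, W⟩ := p
  rw [ha, cechD0_apply, ← hb U, ← hb W, secRes_sumSec, secRes_sumSec, ← map_sub]
  rfl

variable [IsIntegral C] [hH : SheafOfModules.IsFinitePresentation (R := C.ringCatSheaf) H]

/-- Since `H` is generated by the sections `s i` up to torsion, `H¹(𝒪)^ι → H¹(H)` is
surjective. -/
lemma LocallySpan.sumCechH1_surjective (hC : HasFiniteQuotients f) (hs : LocallySpan s U₀)
    (hU₀ : (U₀ : Set C).Nonempty) (hind : IsIndependent s) :
    Function.Surjective (sumCechH1 f s) := by
  intro q
  obtain ⟨⟨h, hh⟩, rfl⟩ := Submodule.Quotient.mk_surjective _ q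
  have hh' : cechD1 f H h = 0 := hh
  choose A hA using exists_affine_mem (C := C)
  -- correct `h` by a coboundary so that its values lie in the span of the `s i`
  choose n hn using fun V : C.affineOpens => hs.exists_approximation hC hU₀ hind V.2
    (fun x => (A x).1 ⊓ V.1) (fun x hx => ⟨hA x, hx⟩)
    (fun x => (show Γ(H, (A x).1 ⊓ V.1) from h (A x, V)))
  let n' : ∀ U : C.affineOpens, Sec f H U := fun U => n U
  have hg : ∀ U V : C.affineOpens,
      h (U, V) - cechD0 f H n' (U, V) ∈ secSpan f s (U.1 ⊓ V.1) := by
    intro U V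
    refine hind.mem_secSpan_of_locally fun x hx => ?_
    obtain ⟨W, hWU, hWA, hxW, hW⟩ := hn U x hx.1
    obtain ⟨W', hWV', hWA', hxW', hW'⟩ := hn V x hx.2
    have h1 := secRes_mem_secSpan (f := f) (inf_le_left : W ⊓ W' ≤ W)
      (t := secRes f H hWU (n' U) - secRes f H hWA (h (A x, U))) hW
    have h2 := secRes_mem_secSpan (f := f) (inf_le_right : W ⊓ W' ≤ W')
      (t := secRes f H hWV' (n' V) - secRes f H hWA' (h (A x, V))) hW'
    have hYU : W ⊓ W' ≤ U.1 := inf_le_left.trans hWU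
    have hYV : W ⊓ W' ≤ V.1 := inf_le_right.trans hWV'
    refine ⟨W ⊓ W', le_inf hYU hYV, ⟨hxW, hxW'⟩, ?_⟩
    have h3 := cocycle_relation hh' (A x) U V
      (inf_le_left.trans (hWA.trans inf_le_left) : W ⊓ W' ≤ _) hYU hYV
    rw [map_sub, secRes_secRes, secRes_secRes] at h1 h2
    rw [map_sub, cechD0_apply, map_sub, secRes_secRes, secRes_secRes]
    rw [sub_add, sub_eq_zero] at h3
    rw [h3]
    have := Submodule.sub_mem _ h1 h2
    convert this using 1
    abel
  choose a ha using fun p : C.affineOpens × C.affineOpens =>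
    (mem_range_sumSec_iff f s).1 (hg p.1 p.2)
  have hcocycle : ∀ i, (fun p => a p i) ∈ LinearMap.ker (cechD1 f (structureModule C)) := by
    intro i
    rw [LinearMap.mem_ker]
    funext t
    suffices H : (fun i => cechD1 f (structureModule C) (fun p => a p i) t) = 0 from congrFun H i
    apply hind.sumSec_injective
    rw [map_zero]
    have h1 : cechD1 f H (fun p => sumSec f s _ (a p)) = 0 := by
      have : (fun p => sumSec f s _ (a p)) = h - cechD0 f H n' := funext ha
      rw [this, map_sub, hh', zero_sub, neg_eq_zero]
      funext t
      obtain ⟨U, V, W⟩ := t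
      simp only [cechD1_apply, cechD0_apply, map_sub, secRes_secRes]
      have habel : ∀ x y z : Sec f H (U.1 ⊓ (V.1 ⊓ W.1)), (z - y) - (z - x) + (y - x) = 0 :=
        fun x y z => by abel
      exact habel _ _ _
    refine Eq.trans ?_ (congrFun h1 t)
    obtain ⟨U, V, W⟩ := t
    rw [cechD1_apply]
    simp only [secRes_sumSec, ← map_sub, ← map_add]
    rfl
  refine ⟨fun i => Submodule.Quotient.mk ⟨fun p => a p i, hcocycle i⟩, ?_⟩
  rw [sumCechH1_mk, Submodule.Quotient.eq]
  refine ⟨-n', ?_⟩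
  funext p
  rw [map_neg]
  have h1 := sum_mulCocycle_apply (s := s)
    (fun i => (⟨fun p => a p i, hcocycle i⟩ : LinearMap.ker (cechD1 f (structureModule C)))) p
  have h2 : (∑ i, mulCocycle f (s i) ⟨fun p => a p i, hcocycle i⟩).1 p - h p =
      - cechD0 f H n' p := by
    rw [h1]
    change sumSec f s _ (a p) - h p = _
    rw [ha p, sub_sub_cancel_left]
  exact h2.symm

/-- A finite cover by affine open sets, on each of which the span of the `s i` has finite
codimension. -/
lemma LocallySpan.exists_finite_cover [CompactSpace C] (hC : HasFiniteQuotients f)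
    (hs : LocallySpan s U₀) (hU₀ : (U₀ : Set C).Nonempty) (hind : IsIndependent s) :
    ∃ (T : Finset C) (V : C → C.affineOpens), (∀ x : C, ∃ y ∈ T, x ∈ (V y).1) ∧
      ∀ y, Module.Finite k (Sec f H (V y) ⧸ secSpan f s (V y).1) := by
  have key : ∀ x : C, ∃ V : C.affineOpens, x ∈ V.1 ∧
      Module.Finite k (Sec f H V ⧸ secSpan f s V.1) := by
    intro x
    obtain ⟨U, hxU, n, g, hg⟩ := exists_locallySpan_of_isFinitePresentation H x
    obtain ⟨V, hV, hxV, hVU⟩ := exists_isAffineOpen_mem_and_subset hxU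
    exact ⟨⟨V, hV⟩, hxV, finite_quotient_secSpan hC hs hU₀ hind hV ⟨x, hxV⟩ (hg.restrict hVU)⟩
  choose V hxV hV using key
  obtain ⟨T, hT⟩ := isCompact_univ.elim_finite_subcover (fun x => ((V x).1 : Set C))
    (fun x => (V x).1.isOpen) (fun x _ => Set.mem_iUnion.2 ⟨x, hxV x⟩)
  refine ⟨T, V, fun x => ?_, hV⟩
  obtain ⟨y, hy⟩ := Set.mem_iUnion.1 (hT (Set.mem_univ x))
  obtain ⟨hyT, hxy⟩ := Set.mem_iUnion.1 hy
  exact ⟨y, hyT, hxy⟩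

lemma LocallySpan.finite_ker_sumCechH1 [CompactSpace C] (hC : HasFiniteQuotients f)
    (hs : LocallySpan s U₀) (hU₀ : (U₀ : Set C).Nonempty) (hind : IsIndependent s) :
    Module.Finite k (LinearMap.ker (sumCechH1 f s)) := by
  obtain ⟨T, V, hT, hV⟩ := hs.exists_finite_cover hC hU₀ hind
  let Z := LinearMap.ker (cechD1 f (structureModule C))
  let Ψ₁ : (ι → Z) →ₗ[k] (∀ p : C.affineOpens × C.affineOpens, Sec f H (p.1 ⊓ p.2)) :=
    (LinearMap.ker (cechD1 f H)).subtype ∘ₗ ∑ i, mulCocycle f (s i) ∘ₗ LinearMap.proj i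
  have hΨ₁ : ∀ a, Ψ₁ a = (∑ i, mulCocycle f (s i) (a i)).1 := by
    intro a
    simp only [Ψ₁, LinearMap.comp_apply, LinearMap.sum_apply]
    rfl
  -- pairs of cocycles `a` and a cochain `n` of `H` with `∑ i, a i • s i = d n`
  refine finite_of_lift_of_ker_le
    (V := (ι → Z) × (∀ U : C.affineOpens, Sec f H U))
    (F := ∀ y : T, Sec f H (V y) ⧸ secSpan f s (V y).1)
    (Ψ₁ ∘ₗ LinearMap.fst k _ _ - cechD0 f H ∘ₗ LinearMap.snd k _ _)
    (LinearMap.pi fun y => Submodule.mkQ _ ∘ₗ LinearMap.proj (V y) ∘ₗ LinearMap.snd k _ _)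
    ((LinearMap.pi fun i => Submodule.mkQ _ ∘ₗ LinearMap.proj i) ∘ₗ LinearMap.fst k _ _)
    (fun x hx hρ => ?_) _ fun q hq => ?_
  · have hx' : Ψ₁ x.1 = cechD0 f H x.2 := sub_eq_zero.1 hx
    rw [hΨ₁] at hx'
    have hT' : ∀ z : C, ∃ W ∈ V '' (T : Set C), z ∈ W.1 := by
      intro z
      obtain ⟨y, hy, hz⟩ := hT z
      exact ⟨V y, ⟨y, hy, rfl⟩, hz⟩
    funext i
    refine (Submodule.Quotient.mk_eq_zero _).2 ?_
    refine hind.exists_cechD0_eq hT' (fun i => (x.1 i).1) x.2 (fun p => ?_) ?_ i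
    · rw [← hx', sum_mulCocycle_apply]
    · rintro _ ⟨y, hy, rfl⟩
      exact (Submodule.Quotient.mk_eq_zero _).1 (congrFun hρ ⟨y, hy⟩)
  · choose a ha using fun i => Submodule.Quotient.mk_surjective _ (q i)
    obtain rfl : (fun i => Submodule.Quotient.mk (a i)) = q := funext ha
    rw [LinearMap.mem_ker, sumCechH1_mk, Submodule.Quotient.mk_eq_zero] at hq
    obtain ⟨n, hn⟩ := hq
    refine ⟨(a, n), ?_, rfl⟩
    refine sub_eq_zero.2 ?_
    exact (hΨ₁ a).trans hn.symm

lemma LocallySpan.finite_quotient_range_sumSec [CompactSpace C] (hC : HasFiniteQuotients f)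
    (hs : LocallySpan s U₀) (hU₀ : (U₀ : Set C).Nonempty) (hind : IsIndependent s) :
    Module.Finite k (Sec f H ⊤ ⧸ LinearMap.range (sumSec f s ⊤)) := by
  obtain ⟨T, V, hT, hV⟩ := hs.exists_finite_cover hC hU₀ hind
  have h := finite_of_lift_of_ker_le (F := ∀ y : T, Sec f H (V y) ⧸ secSpan f s (V y).1)
    (0 : Sec f H ⊤ →ₗ[k] k) (LinearMap.pi fun y => Submodule.mkQ _ ∘ₗ secRes f H le_top)
    (LinearMap.range (sumSec f s ⊤)).mkQ (by
      intro t _ ht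
      rw [Submodule.mkQ_apply, Submodule.Quotient.mk_eq_zero]
      refine (mem_range_sumSec_iff f s).1 (hind.mem_secSpan_of_locally fun x _ => ?_)
      obtain ⟨y, hyT, hxy⟩ := hT x
      exact ⟨(V y).1, le_top, hxy, (Submodule.Quotient.mk_eq_zero _).1 (congrFun ht ⟨y, hyT⟩)⟩)
    ⊤ (by
      rintro q -
      obtain ⟨t, rfl⟩ := Submodule.Quotient.mk_surjective _ q
      exact ⟨t, rfl, rfl⟩)
  exact Module.Finite.equiv Submodule.topEquiv

/-- A sheaf with a generic basis of global sections has nonnegative degree. -/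
lemma LocallySpan.degree_nonneg [CompactSpace C] (hC : HasFiniteQuotients f)
    (hs : LocallySpan s U₀) (hU₀ : (U₀ : Set C).Nonempty) (hind : IsIndependent s)
    (hcard : Fintype.card ι = sheafRank H) : 0 ≤ degree f H := by
  have h0 := card_mul_finrank_le (ι := ι) (sumSec f s (⊤ : C.Opens)) (hind.sumSec_injective (f := f) (⊤ : C.Opens))
    (hs.finite_quotient_range_sumSec hC hU₀ hind)
  have h1 := finrank_le_card_mul (sumCechH1 f s) (hs.sumCechH1_surjective hC hU₀ hind)
    (hs.finite_ker_sumCechH1 hC hU₀ hind)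
  have h2 : degree f H = ((Module.finrank k (Sec f H ⊤) : ℤ) - Module.finrank k (CechH1 f H)) -
      sheafRank H * ((Module.finrank k (Sec f (structureModule C) ⊤) : ℤ) -
        Module.finrank k (CechH1 f (structureModule C))) := rfl
  rw [h2, ← hcard]
  zify at h0 h1
  linarith

end Degree

/-! ### Bases at the generic point -/

section GenericBasis

variable {C : Scheme.{u}} {H : C.Modules}

/-- The germ of a section of a sheaf of modules. -/
def modGerm (H : C.Modules) (U : C.Opens) (x : C) (hx : x ∈ U) : Γ(H, U) →+ H.presheaf.stalk x :=
  (H.presheaf.germ U x hx).hom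

lemma modGerm_smul (U : C.Opens) (x : C) (hx : x ∈ U) (a : Γ(C, U)) (t : Γ(H, U)) :
    modGerm H U x hx (a • t) = C.presheaf.germ U x hx a • modGerm H U x hx t :=
  PresheafOfModules.germ_smul (R := C.presheaf) H.val x U hx a t

lemma modGerm_modRes {U V : C.Opens} (h : V ≤ U) (x : C) (hx : x ∈ V) (t : Γ(H, U)) :
    modGerm H V x hx (modRes H h t) = modGerm H U x (h hx) t :=
  TopCat.Presheaf.germ_res_apply H.presheaf (homOfLE h) x hx t

lemma exists_modGerm_eq (x : C) (τ : H.presheaf.stalk x) :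
    ∃ (U : C.Opens) (hx : x ∈ U) (t : Γ(H, U)), modGerm H U x hx t = τ :=
  TopCat.Presheaf.exists_germ_eq H.presheaf τ

lemma exists_modRes_eq_of_modGerm_eq {U : C.Opens} (x : C) (hx : x ∈ U) {s t : Γ(H, U)}
    (h : modGerm H U x hx s = modGerm H U x hx t) :
    ∃ (V : C.Opens) (hV : V ≤ U), x ∈ V ∧ modRes H hV s = modRes H hV t := by
  obtain ⟨W, hxW, i, j, hij⟩ := TopCat.Presheaf.germ_eq H.presheaf x hx hx s t h
  exact ⟨W, leOfHom i, hxW, hij⟩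

lemma mem_of_genericPoint [IsIntegral C] {U : C.Opens} (hU : (U : Set C).Nonempty) :
    genericPoint C ∈ U :=
  ((genericPoint_spec C).mem_open_set_iff U.isOpen).2 (by simpa using hU)

variable [IsIntegral C]

/-- From finitely many global sections which generate `H` on a nonempty open set one can select a
basis of `H` over the generic point. -/
lemma LocallySpan.exists_generic_basis {n : ℕ} {s : Fin n → Γ(H, ⊤)} {U₀ : C.Opens}
    (hs : LocallySpan s U₀) (hU₀ : (U₀ : Set C).Nonempty) :
    ∃ (ι : Type) (_ : Fintype ι) (s' : ι → Γ(H, ⊤)) (U₁ : C.Opens), (U₁ : Set C).Nonempty ∧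
      LocallySpan s' U₁ ∧ IsIndependent s' ∧ Fintype.card ι = sheafRank H := by
  classical
  let η := genericPoint C
  let g : Fin n → H.presheaf.stalk η := fun i => modGerm H ⊤ η trivial (s i)
  obtain ⟨ι, e, he, hspan, hli⟩ := exists_linearIndependent' C.functionField g
  have := Finite.of_injective e he
  have := Fintype.ofFinite ι
  have hg : ⊤ ≤ Submodule.span C.functionField (Set.range g) := by
    rintro τ -
    obtain ⟨U, hηU, t, rfl⟩ := exists_modGerm_eq η τ
    have hη : η ∈ U ⊓ U₀ := ⟨hηU, mem_of_genericPoint hU₀⟩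
    obtain ⟨V, hV, _, a, hηV, ha⟩ := hs (U ⊓ U₀) inf_le_right (modRes H inf_le_left t) η hη
    have h1 := congrArg (modGerm H V η hηV) ha
    rw [modRes_modRes, modGerm_modRes, map_sum] at h1
    rw [h1]
    refine Submodule.sum_mem _ fun i _ => ?_
    rw [modGerm_smul, modGerm_modRes]
    exact Submodule.smul_mem _ _ (Submodule.subset_span ⟨i, rfl⟩)
  let b : Module.Basis ι C.functionField (H.presheaf.stalk η) :=
    Module.Basis.mk hli (hspan ▸ hg)
  let s' : ι → Γ(H, ⊤) := fun i => s (e i)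
  -- each of the given sections lies in the span of the selected ones near the generic point
  have hloc : ∀ j, ∃ W : C.Opens, η ∈ W ∧ modRes H le_top (s j) ∈ spanSections s' W := by
    intro j
    have h1 : g j ∈ Submodule.span C.functionField (Set.range (g ∘ e)) :=
      hspan ▸ Submodule.subset_span ⟨j, rfl⟩
    obtain ⟨c, hc⟩ := (Submodule.mem_span_range_iff_exists_fun _).1 h1
    choose W hηW c' hc' using fun i => C.presheaf.exists_germ_eq (C := CommRingCat) (c i)
    let Y : C.Opens := Finset.univ.inf W
    have hYW : ∀ i, Y ≤ W i := fun i => Finset.inf_le (Finset.mem_univ i)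
    have hηY : η ∈ Y := by
      have : ∀ S : Finset ι, η ∈ S.inf W := by
        intro S
        induction S using Finset.induction_on with
        | empty => exact trivial
        | insert a S _ ih => rw [Finset.inf_insert]; exact ⟨hηW a, ih⟩
      exact this _
    obtain ⟨V, hV, hηV, hVe⟩ := exists_modRes_eq_of_modGerm_eq (H := H) η hηY
      (s := modRes H le_top (s j))
      (t := ∑ i, res (hYW i) (c' i) • modRes H le_top (s' i)) (by
        rw [modGerm_modRes, map_sum]
        refine hc.symm.trans (Finset.sum_congr rfl fun i _ => ?_)
        rw [modGerm_smul, modGerm_modRes]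
        congr 1
        exact (hc' i).symm.trans (C.presheaf.germ_res_apply (homOfLE (hYW i)) η hηY (c' i)).symm)
    refine ⟨V, hηV, ?_⟩
    rw [modRes_modRes] at hVe
    rw [hVe]
    exact modRes_mem_spanSections hV (mem_spanSections_iff.2 ⟨_, rfl⟩)
  choose W hηW hW using hloc
  let Y : C.Opens := Finset.univ.inf W
  have hYW : ∀ i, Y ≤ W i := fun i => Finset.inf_le (Finset.mem_univ i)
  have hηY : η ∈ Y := by
    have : ∀ S : Finset (Fin n), η ∈ S.inf W := by
      intro S
      induction S using Finset.induction_on with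
      | empty => exact trivial
      | insert a S _ ih => rw [Finset.inf_insert]; exact ⟨hηW a, ih⟩
    exact this _
  refine ⟨ι, inferInstance, s', U₀ ⊓ Y, ⟨η, mem_of_genericPoint hU₀, hηY⟩, ?_, ?_, ?_⟩
  · intro U hU t x hx
    obtain ⟨V, hV, _, a, hxV, ha⟩ := hs U (hU.trans inf_le_left) t x hx
    have h1 : modRes H hV t ∈ spanSections s' V := by
      rw [ha]
      refine Submodule.sum_mem _ fun j _ => Submodule.smul_mem _ _ ?_
      have := modRes_mem_spanSections (hV.trans (hU.trans (inf_le_right.trans (hYW j)))) (hW j)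
      rwa [modRes_modRes] at this
    obtain ⟨c, hc⟩ := mem_spanSections_iff.1 h1
    exact ⟨V, hV, le_top, c, hxV, hc.symm⟩
  · intro U a ha
    funext i
    by_cases hU : (U : Set C).Nonempty
    · have hη : η ∈ U := mem_of_genericPoint hU
      have h1 := congrArg (modGerm H U η hη) ha
      rw [map_sum, map_zero] at h1
      simp only [modGerm_smul, modGerm_modRes] at h1
      have h2 := Fintype.linearIndependent_iff.1 hli
        (fun i => C.presheaf.germ U η hη (a i)) h1 i
      exact germ_injective_of_isIntegral C η hη (h2.trans (map_zero _).symm)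
    · exact res_ext fun x hx => (hU ⟨x, hx⟩).elim
  · exact (Module.finrank_eq_card_basis b).symm

end GenericBasis

/-! ### Morphisms from sections, and derivations of the function field -/

section SectionHom

variable {X : Scheme.{u}} {M : X.Modules}

/-- The morphism `𝒪 → M` with `1 ↦ s`. -/
def sectionHom (s : Γ(M, ⊤)) : structureModule X ⟶ M :=
  (SheafOfModules.unitHomEquiv (R := X.ringCatSheaf) M).symm
    (PresheafOfModules.sectionsMk (M := M.val) (fun U => (modRes M (le_top : U.unop ≤ ⊤) s :))
      fun _ _ i => modRes_modRes (M := M) le_top (leOfHom i.unop) s)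

lemma sectionHom_app (s : Γ(M, ⊤)) (U : X.Opens) (a : Γ(X, U)) :
    (sectionHom s).app U (show Γ(structureModule X, U) from a) = a • modRes M le_top s := by
  have h1 : (sectionHom s).app ⊤ (show Γ(structureModule X, ⊤) from (1 : Γ(X, ⊤))) = s := by
    have h2 := SheafOfModules.unitHomEquiv_apply_coe (R := X.ringCatSheaf) M (sectionHom s)
      (Opposite.op ⊤)
    refine h2.symm.trans ?_
    rw [sectionHom, Equiv.apply_symm_apply]
    exact modRes_self s
  rw [structureModule_app_apply, h1]
  rfl

lemma modules_hom_ext {M N : X.Modules} {a b : M ⟶ N} (h : ∀ U t, a.app U t = b.app U t) :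
    a = b := by
  apply Scheme.Modules.hom_ext
  intro U
  ext t
  exact h U t

/-- Global sections which generate `M` locally on `U` exhibit `M` as generated over `U`. -/
lemma LocallySpan.isGeneratedOver {n : ℕ} {s : Fin n → Γ(M, ⊤)} {U : X.Opens}
    (hs : LocallySpan s U) : IsGeneratedOver M U := by
  refine ⟨n, fun i => sectionHom (s i), fun N a b hab => modules_hom_ext fun W t => ?_⟩
  refine modRes_ext fun x hx => ?_
  have hWU : U.ι ''ᵁ W ≤ U := U.ι_image_le W
  obtain ⟨V, hVW, _, c, hxV, hc⟩ := hs (U.ι ''ᵁ W) hWU (show Γ(M, U.ι ''ᵁ W) from t) x.1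
    ⟨x, hx, rfl⟩
  have hV : U.ι ⁻¹ᵁ V ≤ W := by
    intro y hy
    obtain ⟨z, hz, hzy⟩ := hVW hy
    rwa [← U.ι.isOpenEmbedding.injective hzy]
  have hVV : U.ι ''ᵁ U.ι ⁻¹ᵁ V ≤ V := U.ι.image_preimage_le V
  refine ⟨U.ι ⁻¹ᵁ V, hV, hxV, ?_⟩
  rw [← modRes_app, ← modRes_app]
  have h1 : (modRes (M.restrict U.ι) hV t) = ∑ i,
      ((Scheme.Modules.restrictFunctor U.ι).map (sectionHom (s i))).app (U.ι ⁻¹ᵁ V)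
        (show Γ(structureModule X, U.ι ''ᵁ U.ι ⁻¹ᵁ V) from res hVV (c i)) := by
    have h2 := congrArg (modRes M hVV) hc
    rw [modRes_modRes, map_sum] at h2
    refine h2.trans (Finset.sum_congr rfl fun i _ => ?_)
    rw [modRes_smul, modRes_modRes]
    exact (sectionHom_app (s i) _ _).symm
  rw [h1, map_sum, map_sum]
  refine Finset.sum_congr rfl fun i _ => ?_
  exact ConcreteCategory.congr_hom (congrArg (fun φ => φ.app (U.ι ⁻¹ᵁ V)) (hab i)) _

end SectionHom

section ExtendDerivation

/-- A ring homomorphism from a domain to the dual numbers over its field of fractions, lifting the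
inclusion, extends to the field of fractions. -/
lemma exists_trivSqZeroExt_lift {A K : Type*} [CommRing A] [Field K] [Algebra A K]
    [IsFractionRing A K] (φ : A →+* TrivSqZeroExt K K) (hφ : ∀ a, (φ a).fst = algebraMap A K a) :
    ∃ Φ : K →+* TrivSqZeroExt K K, (∀ x, (Φ x).fst = x) ∧ ∀ a, Φ (algebraMap A K a) = φ a := by
  have hu : ∀ y : nonZeroDivisors A, IsUnit (φ y) := by
    intro y
    rw [TrivSqZeroExt.isUnit_iff_isUnit_fst, hφ]
    exact IsLocalization.map_units K y
  refine ⟨IsLocalization.lift hu, ?_, fun a => IsLocalization.lift_eq hu a⟩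
  have : (TrivSqZeroExt.fstHom K K K).toRingHom.comp (IsLocalization.lift hu) = RingHom.id K := by
    apply IsLocalization.ringHom_ext (nonZeroDivisors A)
    ext a
    simp only [RingHom.comp_apply, IsLocalization.lift_eq, RingHom.id_apply]
    exact hφ a
  exact fun x => RingHom.congr_fun this x

variable {k : Type u} [Field k] {X : Scheme.{u}} [IsIntegral X] (f : X ⟶ Spec (.of k))

/-- A function on an integral scheme as a rational function. -/
def ratl (U : X.Opens) (hU : genericPoint X ∈ U) : Γ(X, U) →+* X.functionField :=
  (X.presheaf.germ U (genericPoint X) hU).hom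

lemma ratl_res {U V : X.Opens} (h : V ≤ U) (hV : genericPoint X ∈ V) (s : Γ(X, U)) :
    ratl V hV (res h s) = ratl U (h hV) s :=
  X.presheaf.germ_res_apply (homOfLE h) _ hV s

lemma ratl_injective (U : X.Opens) (hU : genericPoint X ∈ U) : Function.Injective (ratl U hU) :=
  germ_injective_of_isIntegral X _ hU

lemma eq_of_ratl_eq {U : X.Opens} {s t : Γ(X, U)} (h : ∀ hU, ratl U hU s = ratl U hU t) :
    s = t := by
  by_cases hU : (U : Set X).Nonempty
  · exact ratl_injective U (mem_of_genericPoint hU) (h _)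
  · exact res_ext fun x hx => (hU ⟨x, hx⟩).elim

/-- A `k`-derivation of the function field, in the form of a homomorphism to the dual numbers, which
preserves the coordinate rings of the members of a cover by affine open sets, induces a global
section of the tangent sheaf. -/
lemma exists_tangentSection (Φ : X.functionField →+* TrivSqZeroExt X.functionField X.functionField)
    (hΦ : ∀ x, (Φ x).fst = x)
    (hk : ∀ hU c, (Φ (ratl ⊤ hU (scalar f ⊤ c))).snd = 0)
    (hloc : ∀ x : X, ∃ V : X.Opens, IsAffineOpen V ∧ x ∈ V ∧ ∀ hV (a : Γ(X, V)),
      ∃ b, (Φ (ratl V hV a)).snd = ratl V hV b) :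
    ∃ D : tangentSections f ⊤, ∀ V hV (s : Γ(X, V.1)),
      ratl V.1 hV (D.1 V s) = (Φ (ratl V.1 hV s)).snd := by
  have hmul : ∀ x y, (Φ (x * y)).snd = x * (Φ y).snd + y * (Φ x).snd := by
    intro x y
    rw [map_mul, TrivSqZeroExt.snd_mul, hΦ, hΦ]
    simp [mul_comm y]
  have hlocal : ∀ (V : X.Opens) (s : Γ(X, V)), ∀ x ∈ V, ∃ (W : X.Opens) (hWV : W ≤ V)
      (r : Γ(X, W)), x ∈ W ∧ ∀ hW, ratl W hW r = (Φ (ratl V (hWV hW) s)).snd := by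
    intro V s x hx
    obtain ⟨A, hA, hxA, hAD⟩ := hloc x
    obtain ⟨g, hgV, hxg⟩ := hA.exists_basicOpen_le ⟨x, hx⟩ hxA
    have hη : genericPoint X ∈ X.basicOpen g := mem_of_genericPoint ⟨x, hxg⟩
    obtain ⟨l, hl⟩ := exists_res_eq_pow_mul hA g (res hgV s)
    obtain ⟨n, hn⟩ := hl l le_rfl
    have hηA := X.basicOpen_le g hη
    obtain ⟨dn, hdn⟩ := hAD hηA n
    obtain ⟨dh, hdh⟩ := hAD hηA (g ^ l)
    obtain ⟨u, hu⟩ := ((res_basicOpen_isUnit g).pow l).exists_left_inv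
    refine ⟨X.basicOpen g, hgV, u * (res (X.basicOpen_le g) dn -
      res hgV s * res (X.basicOpen_le g) dh), hxg, fun hW => ?_⟩
    -- near `x` one has `s = n / g ^ l`, and the quotient rule applies
    have h1 := congrArg (ratl _ hη) hn
    have h2 := congrArg (ratl _ hη) hu
    rw [map_mul, ← map_pow, ratl_res] at h2
    rw [map_mul, ← map_pow, ratl_res, ratl_res, ratl_res] at h1
    have h3 := congrArg (fun x => (Φ x).snd) h1
    simp only [hmul, hdn, hdh] at h3
    rw [map_mul, map_sub, map_mul, ratl_res, ratl_res, ratl_res, h3, add_sub_cancel_right,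
      ← mul_assoc, h2, map_one, one_mul]
  have hex : ∀ (V : X.Opens) (s : Γ(X, V)), ∃ r : Γ(X, V), ∀ hV,
      ratl V hV r = (Φ (ratl V hV s)).snd := by
    intro V s
    by_cases hV : (V : Set X).Nonempty
    swap
    · exact ⟨0, fun h => (hV ⟨_, h⟩).elim⟩
    choose W hWV r hxW hr using hlocal V s
    let W' : V → X.Opens := fun x => W x.1 x.2
    obtain ⟨r', hr', -⟩ := exists_unique_glue W' V
      (fun x hx => TopologicalSpace.Opens.mem_iSup.2 ⟨⟨x, hx⟩, hxW x hx⟩)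
      (fun x => res inf_le_right (r x.1 x.2)) (by
        intro x y
        refine eq_of_ratl_eq fun h => ?_
        rw [ratl_res, ratl_res, ratl_res, ratl_res, hr, hr])
    refine ⟨r', fun hηV => ?_⟩
    have hη : genericPoint X ∈ V ⊓ W' ⟨_, hηV⟩ := ⟨hηV, hxW _ hηV⟩
    have := congrArg (ratl _ hη) (hr' ⟨_, hηV⟩)
    rw [ratl_res, ratl_res, hr] at this
    exact this
  choose E hE using hex
  refine ⟨⟨fun V s => E V.1 s, fun V s t => ?_, fun V s t => ?_, fun V c => ?_,
    fun V W h s => ?_⟩, fun V hV s => hE _ _ _⟩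
  · refine eq_of_ratl_eq fun h => ?_
    rw [map_add, hE, hE, hE, map_add, map_add, TrivSqZeroExt.snd_add]
  · refine eq_of_ratl_eq fun h => ?_
    rw [map_add, map_mul, map_mul, hE, hE, hE, map_mul, hmul]
  · refine eq_of_ratl_eq fun h => ?_
    rw [hE, map_zero, ← res_scalar f le_top, ratl_res]
    exact hk _ c
  · refine eq_of_ratl_eq fun hη => ?_
    rw [ratl_res, hE, hE, ratl_res]

end ExtendDerivation

/-! ### The charts of a toric variety -/

section ToricCharts

variable (k : Type u) [Field k] {n : ℕ} (Δ : Fan n)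

instance (σ : Δ.cones) : IsOpenImmersion (Δ.chart k σ) :=
  inferInstanceAs (IsOpenImmersion (colimit.ι (chartDiagram k Δ) σ))

lemma exists_chart_eq (x : Δ.toricVariety k) : ∃ σ y, Δ.chart k σ y = x :=
  Scheme.IsLocallyDirected.ι_jointly_surjective (chartDiagram k Δ) x

lemma chart_structureMap (σ : Δ.cones) : Δ.chart k σ ≫ Δ.structureMap k =
    Spec.map (CommRingCat.ofHom (algebraMap k (ChartRing k σ.1))) :=
  colimit.ι_desc _ σ

/-- The open subset `U_σ` of the toric variety. -/
abbrev Fan.chartOpen (σ : Δ.cones) : (Δ.toricVariety k).Opens := Δ.chart k σ ''ᵁ ⊤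

lemma isAffineOpen_chartOpen (σ : Δ.cones) : IsAffineOpen (Δ.chartOpen k σ) :=
  (isAffineOpen_top _).image_of_isOpenImmersion _

/-- The identification of `k[σ^∨ ∩ M]` with the functions on `U_σ`. -/
def Fan.chartSec (σ : Δ.cones) : ChartRing k σ.1 ≃+* Γ(Δ.toricVariety k, Δ.chartOpen k σ) :=
  ((Scheme.ΓSpecIso (.of (ChartRing k σ.1))).symm ≪≫
    ((Δ.chart k σ).appIso ⊤).symm).commRingCatIsoToRingEquiv

variable {X Y Z : Scheme.{u}}

lemma appIso_inv_comp_map (i : Z ⟶ Y) (g : Y ⟶ X) (h : Z ⟶ X) [IsOpenImmersion g]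
    [IsOpenImmersion h] (hi : i ≫ g = h) (hle : h ''ᵁ ⊤ ≤ g ''ᵁ ⊤) :
    (g.appIso ⊤).inv ≫ X.presheaf.map (homOfLE hle).op = i.appTop ≫ (h.appIso ⊤).inv := by
  subst hi
  rw [Iso.inv_comp_eq, ← Category.assoc, Iso.eq_comp_inv, Scheme.Hom.appIso_hom',
    Scheme.Hom.appIso_hom', Scheme.Hom.map_appLE]
  have h : i.appTop = i.appLE ⊤ (i ⁻¹ᵁ ⊤) le_rfl := i.appLE_eq_app.symm
  rw [h]
  exact (Scheme.Hom.appLE_comp_appLE i g _ ⊤ (i ⁻¹ᵁ ⊤) _ _).symm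

lemma map_chart (σ : Δ.cones) : Spec.map (CommRingCat.ofHom (chartRingMap k bot_le)) ≫
    Δ.chart k σ = Δ.chart k ⟨⊥, Δ.bot_mem⟩ :=
  colimit.w (chartDiagram k Δ) (homOfLE (bot_le : (⊥ : PointedCone ℝ (Fin n → ℝ)) ≤ σ.1) :
    (⟨⊥, Δ.bot_mem⟩ : Δ.cones) ⟶ σ)

lemma chartOpen_le (σ : Δ.cones) : Δ.chartOpen k ⟨⊥, Δ.bot_mem⟩ ≤ Δ.chartOpen k σ := by
  rintro _ ⟨y, -, rfl⟩
  rw [← map_chart k Δ σ]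
  exact ⟨_, trivial, rfl⟩

lemma res_chartSec (σ : Δ.cones) (a : ChartRing k σ.1) :
    res (chartOpen_le k Δ σ) (Δ.chartSec k σ a) =
      Δ.chartSec k ⟨⊥, Δ.bot_mem⟩ (chartRingMap k bot_le a) := by
  have h : (Scheme.ΓSpecIso (.of (ChartRing k σ.1))).inv ≫ ((Δ.chart k σ).appIso ⊤).inv ≫
      (Δ.toricVariety k).presheaf.map (homOfLE (chartOpen_le k Δ σ)).op =
      CommRingCat.ofHom (chartRingMap k bot_le) ≫ (Scheme.ΓSpecIso (.of (ChartRing k ⊥))).inv ≫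
        ((Δ.chart k ⟨⊥, Δ.bot_mem⟩).appIso ⊤).inv := by
    rw [appIso_inv_comp_map _ _ _ (map_chart k Δ σ) (chartOpen_le k Δ σ), ← Category.assoc,
      ← Scheme.ΓSpecIso_inv_naturality, Category.assoc]
  exact congrArg (fun φ => φ.hom a) h

lemma chartSec_algebraMap (σ : Δ.cones) (c : k) :
    Δ.chartSec k σ (algebraMap k _ c) = scalar (Δ.structureMap k) (Δ.chartOpen k σ) c := by
  have h : CommRingCat.ofHom (algebraMap k (ChartRing k σ.1)) ≫
      (Scheme.ΓSpecIso (.of (ChartRing k σ.1))).inv ≫ ((Δ.chart k σ).appIso ⊤).inv =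
      (Scheme.ΓSpecIso (.of k)).inv ≫ (Δ.structureMap k).appTop ≫
        (Δ.toricVariety k).presheaf.map (homOfLE (le_top : Δ.chartOpen k σ ≤ ⊤)).op := by
    rw [← Category.assoc, Iso.comp_inv_eq, Scheme.ΓSpecIso_inv_naturality, ← chart_structureMap]
    simp only [Category.assoc]
    congr 1
    have h1 := (Δ.structureMap k).appLE_eq_app (U := ⊤)
    rw [Scheme.Hom.appIso_hom']
    refine (Scheme.Hom.comp_appTop _ _).trans ?_
    congr 1
    have h2 := Scheme.Hom.map_appLE (Δ.chart k σ)
      (e := (Scheme.Hom.preimage_image_eq (Δ.chart k σ) ⊤).ge)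
      (homOfLE (le_top : Δ.chartOpen k σ ≤ ⊤)).op
    exact (Scheme.Hom.appLE_eq_app _).symm.trans h2.symm
  exact congrArg (fun φ => φ.hom c) h

end ToricCharts

/-! ### Invariant vector fields on a toric variety -/

section LogDerivations

variable (k : Type u) [Field k] {n : ℕ} (Δ : Fan n)

/-- The dense torus of the toric variety. -/
abbrev Fan.torus : (Δ.toricVariety k).Opens := Δ.chartOpen k ⟨⊥, Δ.bot_mem⟩

lemma one_mem_torus : Δ.one k ∈ Δ.torus k := ⟨_, trivial, rfl⟩

lemma mem_dualMonoid_bot (m : Fin n → ℤ) :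
    m ∈ dualMonoid (⊥ : PointedCone ℝ (Fin n → ℝ)) := by
  intro v hv
  rw [(Submodule.mem_bot _).1 hv, pairing_zero_right]

/-- The character `χ^m` of the torus, as a function. -/
def Fan.char (m : Fin n → ℤ) : Γ(Δ.toricVariety k, Δ.torus k) :=
  Δ.chartSec k ⟨⊥, Δ.bot_mem⟩ (AddMonoidAlgebra.single ⟨m, mem_dualMonoid_bot m⟩ 1)

lemma char_zero : Δ.char k 0 = 1 := map_one (Δ.chartSec k ⟨⊥, Δ.bot_mem⟩)

lemma char_add (m m' : Fin n → ℤ) : Δ.char k (m + m') = Δ.char k m * Δ.char k m' := by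
  rw [Fan.char, Fan.char, Fan.char, ← map_mul, AddMonoidAlgebra.single_mul_single, one_mul]
  rfl

lemma char_neg_mul (m : Fin n → ℤ) : Δ.char k (-m) * Δ.char k m = 1 := by
  rw [← char_add, neg_add_cancel, char_zero]

/-- A monomial `c χ^m` in the coordinate ring of a chart, as a function on the torus. -/
lemma res_chartSec_single (σ : Δ.cones) (m : dualMonoid σ.1) (c : k) :
    res (chartOpen_le k Δ σ) (Δ.chartSec k σ (AddMonoidAlgebra.single m c)) =
      scalar (Δ.structureMap k) (Δ.torus k) c * Δ.char k m.1 := by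
  rw [res_chartSec, chartRingMap_single, ← chartSec_algebraMap, Fan.char, ← map_mul,
    AddMonoidAlgebra.coe_algebraMap, Function.comp_apply, AddMonoidAlgebra.single_mul_single,
    zero_add, Algebra.algebraMap_self_apply, mul_one]
  rfl

lemma chartSec_bot_single (m : dualMonoid (⊥ : PointedCone ℝ (Fin n → ℝ))) (c : k) :
    Δ.chartSec k ⟨⊥, Δ.bot_mem⟩ (AddMonoidAlgebra.single m c) =
      scalar (Δ.structureMap k) (Δ.torus k) c * Δ.char k m.1 := by
  rw [← res_chartSec_single k Δ ⟨⊥, Δ.bot_mem⟩, res_self]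

/-- A derivation over an open subset of the torus which kills the coordinate characters is zero. -/
lemma eq_zero_of_char {V : (Δ.toricVariety k).Opens} (hV : V ≤ Δ.torus k)
    (E : tangentSections (Δ.structureMap k) V)
    (hE : ∀ i, E.1 ⟨V, le_rfl⟩ (res hV (Δ.char k (Pi.single i 1))) = 0) : E = 0 := by
  obtain ⟨E, h1, h2, h3, h4⟩ := E
  refine Subtype.ext (funext fun ⟨W, hW⟩ => funext fun s => ?_)
  change E ⟨W, hW⟩ s = 0
  have hWT := hW.trans hV
  let δ : Γ(Δ.toricVariety k, W) →+ Γ(Δ.toricVariety k, W) := AddMonoidHom.mk' (E ⟨W, hW⟩) (h1 ⟨W, hW⟩)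
  have hmul : ∀ s t, δ (s * t) = s * δ t + t * δ s := h2 ⟨W, hW⟩
  let x : (Fin n → ℤ) → Γ(Δ.toricVariety k, W) := fun m => res hWT (Δ.char k m)
  have hx : ∀ m m', x (m + m') = x m * x m' := fun m m' => by
    simp only [x, char_add, map_mul]
  have hneg : ∀ m, x (-m) * x m = 1 := fun m => by
    simp only [x, ← map_mul, char_neg_mul, map_one]
  -- the logarithmic derivatives of the characters are additive
  let L : (Fin n → ℤ) →+ Γ(Δ.toricVariety k, W) := AddMonoidHom.mk' (fun m => x (-m) * δ (x m)) (by
    intro m m'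
    rw [neg_add, hx, hx, hmul]
    linear_combination (x (-m') * δ (x m')) * hneg m + (x (-m) * δ (x m)) * hneg m')
  have hL : L = 0 := by
    refine AddMonoidHom.functions_ext _ _ _ fun i c => ?_
    have hi : L.comp (AddMonoidHom.single (fun _ : Fin n => ℤ) i) = 0 := by
      refine AddMonoidHom.ext_int ?_
      change x (-Pi.single i 1) * δ (x (Pi.single i 1)) = 0
      have h5 : δ (x (Pi.single i 1)) = 0 := by
        have h6 := h4 ⟨V, le_rfl⟩ ⟨W, hW⟩ hW (res hV (Δ.char k (Pi.single i 1)))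
        rw [show E ⟨V, le_rfl⟩ _ = 0 from hE i, map_zero, res_res] at h6
        exact h6.symm
      rw [h5, mul_zero]
    exact DFunLike.congr_fun hi c
  have hδx : ∀ m, δ (x m) = 0 := by
    intro m
    have h5 : x (-m) * δ (x m) = 0 := DFunLike.congr_fun hL m
    have h6 := hneg m
    linear_combination (x m) * h5 - δ (x m) * h6
  have hδ : ∀ a : Γ(Δ.toricVariety k, Δ.torus k), δ (res hWT a) = 0 := by
    intro a
    obtain ⟨a, rfl⟩ := (Δ.chartSec k ⟨⊥, Δ.bot_mem⟩).surjective a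
    induction a using AddMonoidAlgebra.induction_linear with
    | zero => simp
    | add a b ha hb => simp only [map_add, ha, hb, add_zero]
    | single m c =>
      rw [chartSec_bot_single, map_mul, hmul, res_scalar]
      have h5 : δ (scalar (Δ.structureMap k) W c) = 0 := h3 ⟨W, hW⟩ c
      have h6 : δ (res hWT (Δ.char k m.1)) = 0 := hδx m.1
      rw [h5, h6, mul_zero, mul_zero, add_zero]
  refine res_ext fun y hy => ?_
  have haff := isAffineOpen_chartOpen k Δ ⟨⊥, Δ.bot_mem⟩
  obtain ⟨g, hgW, hyg⟩ := haff.exists_basicOpen_le ⟨y, hy⟩ (hWT hy)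
  refine ⟨_, hgW, hyg, ?_⟩
  obtain ⟨l, hl⟩ := exists_res_eq_pow_mul haff g (res hgW s)
  obtain ⟨b, hb⟩ := hl l le_rfl
  have hE0 : ∀ a : Γ(Δ.toricVariety k, Δ.torus k),
      E ⟨_, hgW.trans hW⟩ (res ((Δ.toricVariety k).basicOpen_le g) a) = 0 := by
    intro a
    have h5 := h4 ⟨W, hW⟩ ⟨_, hgW.trans hW⟩ hgW (res hWT a)
    rw [show E ⟨W, hW⟩ (res hWT a) = 0 from hδ a, map_zero, res_res] at h5
    exact h5.symm
  have h5 := h2 ⟨_, hgW.trans hW⟩ (res ((Δ.toricVariety k).basicOpen_le g) g ^ l) (res hgW s)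
  rw [← hb, hE0, ← map_pow, hE0, mul_zero, add_zero] at h5
  have hu := (res_basicOpen_isUnit g).pow l
  rw [map_zero, h4 ⟨W, hW⟩ ⟨_, hgW.trans hW⟩ hgW s]
  rw [← map_pow] at hu
  exact (hu.mul_right_eq_zero).1 h5.symm

variable [IsIntegral (Δ.toricVariety k)]

lemma genericPoint_mem_torus : genericPoint (Δ.toricVariety k) ∈ Δ.torus k :=
  mem_of_genericPoint ⟨_, one_mem_torus k Δ⟩

/-- The homomorphism `k[M] → K[ε]`, `χ^m ↦ χ^m + m_i χ^m ε`, for the function field `K`. It encodes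
the derivation `χ^m ↦ m_i χ^m` in a form which extends to the field of fractions by the universal
property of localization. -/
def Fan.logDual (i : Fin n) : ChartRing k (⊥ : PointedCone ℝ (Fin n → ℝ)) →+*
    TrivSqZeroExt (Δ.toricVariety k).functionField (Δ.toricVariety k).functionField :=
  AddMonoidAlgebra.liftNCRingHom
    ((TrivSqZeroExt.inlHom _ _).comp ((ratl _ (genericPoint_mem_torus k Δ)).comp
      (scalar (Δ.structureMap k) (Δ.torus k))))
    { toFun m := TrivSqZeroExt.inl (ratl _ (genericPoint_mem_torus k Δ) (Δ.char k m.toAdd.1)) +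
        TrivSqZeroExt.inr ((m.toAdd.1 i : (Δ.toricVariety k).functionField) *
          ratl _ (genericPoint_mem_torus k Δ) (Δ.char k m.toAdd.1))
      map_one' := by
        have h : ((1 : Multiplicative (dualMonoid (⊥ : PointedCone ℝ (Fin n → ℝ)))).toAdd).1 = 0 :=
          rfl
        rw [h, char_zero, map_one]
        ext <;> simp
      map_mul' m m' := by
        have h : (m * m').toAdd.1 = m.toAdd.1 + m'.toAdd.1 := rfl
        rw [h, char_add, map_mul]
        ext
        · simp
        · simp
          ring }
    (fun _ _ => Commute.all _ _)

lemma logDual_single (i : Fin n) (m : dualMonoid (⊥ : PointedCone ℝ (Fin n → ℝ))) (c : k) :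
    (Δ.logDual k i (AddMonoidAlgebra.single m c)).fst = ratl _ (genericPoint_mem_torus k Δ)
        (Δ.chartSec k ⟨⊥, Δ.bot_mem⟩ (AddMonoidAlgebra.single m c)) ∧
    (Δ.logDual k i (AddMonoidAlgebra.single m c)).snd = (m.1 i : (Δ.toricVariety k).functionField) *
      ratl _ (genericPoint_mem_torus k Δ)
        (Δ.chartSec k ⟨⊥, Δ.bot_mem⟩ (AddMonoidAlgebra.single m c)) := by
  rw [Fan.logDual, AddMonoidAlgebra.liftNCRingHom_single, chartSec_bot_single, map_mul]
  constructor
  · simp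
  · simp
    ring

/-- The invariant vector field on the torus which is dual to the `i`-th coordinate of `M` extends to
the toric variety. -/
lemma exists_logDerivation (i : Fin n) :
    ∃ D : tangentSections (Δ.structureMap k) ⊤, ∀ m : Fin n → ℤ,
      D.1 ⟨Δ.torus k, le_top⟩ (Δ.char k m) =
        (m i : Γ(Δ.toricVariety k, Δ.torus k)) * Δ.char k m := by
  have hη := genericPoint_mem_torus k Δ
  have : Nonempty (Δ.torus k) := ⟨⟨_, hη⟩⟩
  have := functionField_isFractionRing_of_isAffineOpen _ (Δ.torus k)
    (isAffineOpen_chartOpen k Δ ⟨⊥, Δ.bot_mem⟩)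
  let e := Δ.chartSec k ⟨⊥, Δ.bot_mem⟩
  obtain ⟨Φ, hΦ, hΦφ⟩ := exists_trivSqZeroExt_lift (A := Γ(Δ.toricVariety k, Δ.torus k))
    (K := (Δ.toricVariety k).functionField) ((Δ.logDual k i).comp e.symm.toRingHom) (by
      intro a
      obtain ⟨a, rfl⟩ := e.surjective a
      have h1 : (Δ.logDual k i) a = (Δ.logDual k i).comp e.symm.toRingHom (e a) := by
        simp
      rw [← h1]
      change _ = ratl _ hη (e a)
      induction a using AddMonoidAlgebra.induction_linear with
      | zero => simp
      | add x y hx hy =>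
        rw [map_add, map_add, map_add, TrivSqZeroExt.fst_add, hx (by simp), hy (by simp)]
      | single m c => exact (logDual_single k Δ i m c).1)
  have hsingle : ∀ m c, (Φ (ratl _ hη (e (AddMonoidAlgebra.single m c)))).snd =
      (m.1 i : (Δ.toricVariety k).functionField) * ratl _ hη (e (AddMonoidAlgebra.single m c)) := by
    intro m c
    have h1 := hΦφ (e (AddMonoidAlgebra.single m c))
    refine (congrArg TrivSqZeroExt.snd h1).trans ?_
    simp only [RingHom.comp_apply, RingEquiv.toRingHom_eq_coe, RingHom.coe_coe,
      RingEquiv.symm_apply_apply]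
    exact (logDual_single k Δ i m c).2
  obtain ⟨D, hD⟩ := exists_tangentSection (Δ.structureMap k) Φ hΦ (by
      intro hU c
      have h1 : ratl ⊤ hU (scalar (Δ.structureMap k) ⊤ c) =
          ratl _ hη (e (AddMonoidAlgebra.single 0 c)) := by
        rw [chartSec_bot_single, ← res_scalar (Δ.structureMap k) (le_top : Δ.torus k ≤ ⊤)]
        rw [show Δ.char k (0 : dualMonoid (⊥ : PointedCone ℝ (Fin n → ℝ))).1 = 1 from
          char_zero k Δ, mul_one, ratl_res]
      rw [h1, hsingle]
      simp) (by
      intro x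
      obtain ⟨σ, y, rfl⟩ := exists_chart_eq k Δ x
      -- on every chart the derivation multiplies the monomial `χ^m` by `m i`
      refine ⟨Δ.chartOpen k σ, isAffineOpen_chartOpen k Δ σ, ⟨y, trivial, rfl⟩, fun hV a => ?_⟩
      obtain ⟨a, rfl⟩ := (Δ.chartSec k σ).surjective a
      induction a using AddMonoidAlgebra.induction_linear with
      | zero => exact ⟨0, by simp⟩
      | add x y hx hy =>
        obtain ⟨b, hb⟩ := hx
        obtain ⟨b', hb'⟩ := hy
        exact ⟨b + b', by simp only [map_add, TrivSqZeroExt.snd_add, hb, hb']⟩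
      | single m c =>
        refine ⟨(m.1 i : Γ(Δ.toricVariety k, Δ.chartOpen k σ)) *
          Δ.chartSec k σ (AddMonoidAlgebra.single m c), ?_⟩
        have h1 : ratl _ hV (Δ.chartSec k σ (AddMonoidAlgebra.single m c)) = ratl _ hη
            (e (AddMonoidAlgebra.single (AddSubmonoid.inclusion
              (dualMonoid_anti (bot_le : (⊥ : PointedCone ℝ (Fin n → ℝ)) ≤ σ.1)) m) c)) := by
          rw [← chartRingMap_single k (bot_le : (⊥ : PointedCone ℝ (Fin n → ℝ)) ≤ σ.1),
            ← res_chartSec, ratl_res]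
        rw [map_mul, map_intCast, h1, hsingle]
        rfl)
  refine ⟨D, fun m => ratl_injective _ hη ?_⟩
  refine (hD ⟨Δ.torus k, le_top⟩ hη (Δ.char k m)).trans ?_
  rw [map_mul, map_intCast]
  exact hsingle _ _

/-- The tangent sheaf of a toric variety is generated over the torus by global vector fields. -/
lemma isGeneratedOver_tangentSheaf :
    IsGeneratedOver (tangentSheaf (Δ.structureMap k)) (Δ.torus k) := by
  choose D hD using exists_logDerivation k Δ
  refine LocallySpan.isGeneratedOver (M := tangentSheaf (Δ.structureMap k))
    (s := fun i => (show Γ(tangentSheaf (Δ.structureMap k), ⊤) from D i)) fun W hW E x hx => ?_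
  let E' : tangentSections (Δ.structureMap k) W := E
  -- the coefficients are the logarithmic derivatives of the coordinate characters
  let c : Fin n → Γ(Δ.toricVariety k, W) := fun i =>
    res hW (Δ.char k (-Pi.single i 1)) * E'.1 ⟨W, le_rfl⟩ (res hW (Δ.char k (Pi.single i 1)))
  refine ⟨W, le_rfl, le_top, c, hx, ?_⟩
  rw [modRes_self]
  have h0 : E' - ∑ i, c i • tangentRestrict (Δ.structureMap k) (le_top : W ≤ ⊤) (D i) = 0 := by
    refine eq_zero_of_char k Δ hW _ fun i => ?_
    have hDj : ∀ j, (D j).1 ⟨W, le_top⟩ (res hW (Δ.char k (Pi.single i 1))) =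
        if j = i then res hW (Δ.char k (Pi.single i 1)) else 0 := by
      intro j
      have h1 := (D j).2.2.2.2 ⟨Δ.torus k, le_top⟩ ⟨W, le_top⟩ hW (Δ.char k (Pi.single i 1))
      rw [hD] at h1
      rw [← h1, map_mul, map_intCast]
      by_cases h : j = i
      · subst h
        simp
      · simp [h]
    have hsum : (E' - ∑ j, c j • tangentRestrict (Δ.structureMap k) (le_top : W ≤ ⊤) (D j)).1
        ⟨W, le_rfl⟩ (res hW (Δ.char k (Pi.single i 1))) =
        E'.1 ⟨W, le_rfl⟩ (res hW (Δ.char k (Pi.single i 1))) -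
        ∑ j, c j * (D j).1 ⟨W, le_top⟩ (res hW (Δ.char k (Pi.single i 1))) := by
      rw [AddSubgroup.coe_sub, AddSubgroup.val_finsetSum, Pi.sub_apply, Pi.sub_apply,
        Finset.sum_apply, Finset.sum_apply]
      congr 1
      refine Finset.sum_congr rfl fun j _ => ?_
      rw [tangentSections_smul_apply, res_self]
      rfl
    rw [hsum]
    simp only [hDj, mul_ite, mul_zero, Finset.sum_ite_eq', Finset.mem_univ, if_true, c]
    have h1 : res hW (Δ.char k (-Pi.single i 1)) * res hW (Δ.char k (Pi.single i 1)) = 1 := by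
      rw [← map_mul, char_neg_mul, map_one]
    linear_combination - E'.1 ⟨W, le_rfl⟩ (res hW (Δ.char k (Pi.single i 1))) * h1
  exact sub_eq_zero.1 h0

end LogDerivations

/-! ### Curves and their normalizations -/

section Curves

/-- In a `T₀` space of dimension one there are no chains of two proper specializations. -/
lemma eq_or_eq_of_specializes {T : Type*} [TopologicalSpace T] [T0Space T]
    (hT : topologicalKrullDim T = 1) {x y z : T} (h : x ⤳ y) (h' : y ⤳ z) : x = y ∨ y = z := by
  by_contra! hne
  let cl : T → TopologicalSpace.IrreducibleCloseds T := fun x =>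
    ⟨closure {x}, isIrreducible_singleton.closure, isClosed_closure⟩
  have hlt : ∀ {x y : T}, x ⤳ y → x ≠ y → cl y < cl x := by
    intro x y hxy hne
    refine lt_of_le_of_ne (specializes_iff_closure_subset.1 hxy) fun h => hne ?_
    have h1 : closure {y} = closure {x} := congrArg TopologicalSpace.IrreducibleCloseds.carrier h
    exact (inseparable_iff_closure_eq.2 h1.symm).eq
  rcases Order.krullDim_le_one_iff.1 hT.le (cl y) with h1 | h1
  · exact h1.not_lt (hlt h' hne.2)
  · exact h1.not_lt (hlt h hne.1)

/-- A finite morphism does not identify a point with a proper specialization of it. -/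
lemma eq_of_specializes_of_isFinite {X Y : Scheme.{u}} (g : X ⟶ Y) [IsFinite g] {x y : X}
    (h : x ⤳ y) (hg : g x = g y) : x = y := by
  have hd := g.isDiscrete_preimage_singleton (g y)
  have := hd.to_subtype
  let x' : g ⁻¹' {g y} := ⟨x, hg⟩
  let y' : g ⁻¹' {g y} := ⟨y, rfl⟩
  have h1 : x' ⤳ y' := Topology.IsInducing.subtypeVal.specializes_iff.1 h
  exact congrArg Subtype.val h1.eq

variable {k : Type u} [Field k]

lemma finiteType_scalar {X : Scheme.{u}} (f : X ⟶ Spec (.of k)) [LocallyOfFiniteType f]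
    {V : X.Opens} (hV : IsAffineOpen V) : (scalar f V).FiniteType := by
  have h1 := f.finiteType_appLE (isAffineOpen_top (Spec (.of k))) hV le_top
  have h2 : scalar f V = (f.appLE ⊤ V le_top).hom.comp
      (Scheme.ΓSpecIso (.of k)).symm.commRingCatIsoToRingEquiv.toRingHom := by
    rfl
  rw [h2]
  exact h1.comp (RingHom.FiniteType.of_surjective _ (RingEquiv.surjective _))

/-- On the normalization of a curve, the quotient of a coordinate ring by a nonzero element is
finite-dimensional: it has finite type and dimension zero, since a finite morphism maps chains of
specializations to chains of the same length. -/
lemma hasFiniteQuotients_of_isFinite {C' C : Scheme.{u}} [IsIntegral C'] (ν : C' ⟶ C) [IsFinite ν]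
    (hC : topologicalKrullDim C = 1) (f : C' ⟶ Spec (.of k)) [LocallyOfFiniteType f] :
    HasFiniteQuotients f := by
  intro V hV a ha
  have hmax : ∀ p : Ideal Γ(C', V), p.IsPrime → a ∈ p → p.IsMaximal := by
    intro p hp hap
    obtain ⟨q, hq, hpq⟩ := p.exists_le_maximal hp.ne_top
    have hqp := hq.isPrime
    have : Nonempty V := by
      by_contra hne
      have : Subsingleton Γ(C', V) := ⟨fun s t => res_ext fun x hx => (hne ⟨⟨x, hx⟩⟩).elim⟩
      exact ha (Subsingleton.elim _ _)
    let x₀ : PrimeSpectrum Γ(C', V) := ⟨⊥, Ideal.isPrime_bot⟩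
    let x₁ : PrimeSpectrum Γ(C', V) := ⟨p, hp⟩
    let x₂ : PrimeSpectrum Γ(C', V) := ⟨q, hqp⟩
    let y : PrimeSpectrum Γ(C', V) → C' := fun x => hV.fromSpec x
    have hyinj : Function.Injective y := hV.fromSpec.isOpenEmbedding.injective
    have hsp : ∀ {x x' : PrimeSpectrum Γ(C', V)}, x ≤ x' → y x ⤳ y x' := fun h =>
      ((PrimeSpectrum.le_iff_specializes _ _).1 h).map hV.fromSpec.continuous
    have h01 : y x₀ ⤳ y x₁ := hsp (show (⊥ : Ideal _) ≤ p from bot_le)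
    have h12 : y x₁ ⤳ y x₂ := hsp (show p ≤ q from hpq)
    -- the chain `0 ≤ p ≤ q` of primes gives a chain of specializations on the curve itself
    rcases eq_or_eq_of_specializes hC (h01.map ν.continuous) (h12.map ν.continuous) with h | h
    · have h1 : x₀ = x₁ := hyinj (eq_of_specializes_of_isFinite ν h01 h)
      have h2 : (⊥ : Ideal _) = p := congrArg PrimeSpectrum.asIdeal h1
      exact (ha (by rwa [← h2, Ideal.mem_bot] at hap)).elim
    · have h1 : x₁ = x₂ := hyinj (eq_of_specializes_of_isFinite ν h12 h)
      have h2 : p = q := congrArg PrimeSpectrum.asIdeal h1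
      rwa [h2]
  have hdim : Ring.KrullDimLE 0 (Γ(C', V) ⧸ Ideal.span {a}) := by
    refine Ring.KrullDimLE.mk₀ fun P hP => ?_
    have hsurj := Ideal.Quotient.mk_surjective (I := Ideal.span {a})
    have h1 : (P.comap (Ideal.Quotient.mk (Ideal.span {a}))).IsMaximal := by
      refine hmax _ (Ideal.IsPrime.comap _) ?_
      rw [Ideal.mem_comap, Ideal.Quotient.eq_zero_iff_mem.2 (Ideal.mem_span_singleton_self a)]
      exact P.zero_mem
    have h2 := Ideal.map_eq_top_or_isMaximal_of_surjective _ hsurj h1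
    rw [Ideal.map_comap_of_surjective _ hsurj] at h2
    exact h2.resolve_left hP.ne_top
  have hft : ((Ideal.Quotient.mk (Ideal.span {a})).comp (scalar f V)).FiniteType :=
    (finiteType_scalar f hV).comp_surjective Ideal.Quotient.mk_surjective
  algebraize [(Ideal.Quotient.mk (Ideal.span {a})).comp (scalar f V)]
  have : Algebra.FiniteType k (Γ(C', V) ⧸ Ideal.span {a}) := hft
  exact (Module.finite_iff_krullDimLE_zero k _).2 hdim

/-- A sheaf which is generated by finitely many global sections on a nonempty open subset of a curve
has no quotients of negative slope. -/
lemma IsGeneratedOver.minSlope_nonneg {C : Scheme.{u}} [IsIntegral C] [CompactSpace C]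
    {f : C ⟶ Spec (.of k)} (hC : HasFiniteQuotients f) {M : C.Modules} {U : C.Opens}
    (hM : IsGeneratedOver M U) (hU : (U : Set C).Nonempty) : 0 ≤ minSlope f M := by
  refine le_iInf fun H => le_iInf fun q => le_iInf fun hq => le_iInf fun hH => ?_
  obtain ⟨n, s, hs⟩ := (hM.of_epi q).exists_locallySpan
  obtain ⟨ι, _, s', U₁, hU₁, hs', hind, hcard⟩ := hs.exists_generic_basis hU
  have hdeg := hs'.degree_nonneg hC hU₁ hind hcard
  rw [slope]
  split_ifs
  · exact le_top
  · have h1 : (0 : ℝ) ≤ degree f H := by exact_mod_cast hdeg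
    exact EReal.coe_nonneg.2 (div_nonneg h1 (Nat.cast_nonneg _))

/-- The iterates of the Frobenius morphism are the identity on points. -/
lemma frobeniusIter_apply {X : Scheme.{u}} (f : X ⟶ Spec (.of k)) (p : ℕ) (hp : p.Prime)
    (h : (p : k) = 0) (e : ℕ) (x : X) : frobeniusIter f p hp h e x = x := by
  induction e generalizing x with
  | zero => rfl
  | succ e ih => exact ih x

lemma IsGeneratedOver.minSlopeBar_nonneg {C : Scheme.{u}} [IsIntegral C] [CompactSpace C]
    {f : C ⟶ Spec (.of k)} (hC : HasFiniteQuotients f) {M : C.Modules} {U : C.Opens}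
    (hM : IsGeneratedOver M U) (hU : (U : Set C).Nonempty) : 0 ≤ minSlopeBar f M := by
  rw [minSlopeBar]
  split_ifs with h
  · exact hM.minSlope_nonneg hC hU
  · refine Filter.le_liminf_of_le (by isBoundedDefault) (Filter.Eventually.of_forall fun e => ?_)
    refine EReal.div_nonneg ((hM.pullback _).minSlope_nonneg hC ?_) ?_
    · obtain ⟨x, hx⟩ := hU
      refine ⟨x, ?_⟩
      change frobeniusIter f _ _ _ e x ∈ U
      rwa [frobeniusIter_apply]
    · exact_mod_cast pow_nonneg (Nat.cast_nonneg (α := ℝ) _) e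

/-- A normalization hits every nonempty open set, since it is an isomorphism over a dense one. -/
lemma IsNormalization.preimage_nonempty {C' C : Scheme.{u}} [IsIntegral C] {ν : C' ⟶ C}
    (hν : IsNormalization ν) {U : C.Opens} (hU : (U : Set C).Nonempty) :
    ((ν ⁻¹ᵁ U : C'.Opens) : Set C').Nonempty := by
  obtain ⟨W, hW, hiso⟩ := hν.birational
  obtain ⟨x, hxU, hxW⟩ := nonempty_preirreducible_inter U.isOpen W.isOpen hU hW
  obtain ⟨y, hy⟩ := (ν ∣_ W).surjective ⟨x, hxW⟩
  refine ⟨y.1, ?_⟩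
  have h1 : ν y.1 = x := by
    have := morphismRestrict_base_coe ν W y
    rw [hy] at this
    exact this.symm
  change ν y.1 ∈ U
  rwa [h1]

end Curves

end ToricSeshadri

end

theorem proposition2p3 {k : Type u} [Field k] [IsAlgClosed k] {n : ℕ}
    (Δ : ToricSeshadri.Fan n) (hcomplete : IsProper (Δ.structureMap k))
    (hfactorial : ToricSeshadri.IsQFactorial (Δ.toricVariety k)) :
    0 ≤ ToricSeshadri.seshadriConstant (Δ.structureMap k)
      (ToricSeshadri.tangentSheaf (Δ.structureMap k)) (Δ.one k) := by
  obtain ⟨hint, -⟩ := hfactorial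
  refine le_iInf fun γ => EReal.div_nonneg ?_ (EReal.coe_ennreal_nonneg _)
  have := γ.isClosedImmersion
  have := γ.isIntegral
  have := γ.isNormalization.isFinite
  have : CompactSpace γ.C' :=
    QuasiCompact.compactSpace_of_compactSpace (γ.ν ≫ γ.ι ≫ Δ.structureMap k)
  refine ((ToricSeshadri.isGeneratedOver_tangentSheaf k Δ).pullback
    (γ.ν ≫ γ.ι)).minSlopeBar_nonneg
    (ToricSeshadri.hasFiniteQuotients_of_isFinite γ.ν γ.dim_eq_one _) ?_
  refine γ.isNormalization.preimage_nonempty (U := γ.ι ⁻¹ᵁ Δ.torus k) ⟨γ.pt, ?_⟩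
  change γ.ι γ.pt ∈ Δ.torus k
  rw [γ.ι_pt]
  exact ToricSeshadri.one_mem_torus k Δ
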